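/- Let $a,m\ge 2$ and let $\tau=12\cdots(m-1)m^a$, where $m^a$ denotes $m$ repeated $a$ times. A partition of $[n]$ with blocks $B_1,\dots,B_k$, $\min B_1<\cdots<\min B_k$, is identified with its canonical sequential form $\pi=\pi_1\cdots\pi_n$, where $i\in B_{\pi_i}$; it is non-crossing if $\pi$ has no subsequence $c\,d\,c\,d$ with $c<d$. Let $NC_n$ be the set of non-crossing partitions of $[n]$ and $C_n=\frac1{n+1}\binom{2n}{n}$. Let $\mu_\tau(\pi)$ be the number of occurrences of $\tau$ in $\pi$ as a subword, i.e. the number of strings of $a+m-1$ consecutive letters of $\pi$ that are order-isomorphic to $\tau$; for $\ell\ge 0$ let $\mu^{(\ell)}_\tau(\pi)$ be the number of occurrences of $\tau$ in the word $12\cdots\ell(\pi+\ell)$, where $\pi+\ell$ is obtained from $\pi$ by adding $\ell$ to every letter. Let $\mathrm{rep}(\pi)$ be the smallest repeated letter of $\pi$, with $\mathrm{rep}(12\cdots n)=0$. Put $$a^{(\ell)}(n)=\sum_{\pi\in NC_n}q^{\mu^{(\ell)}_\tau(\pi)},\qquad a^{(\ell)}(n,i)=\sum_{\pi\in NC_n,\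 \mathrm{rep}(\pi)=i}q^{\mu^{(\ell)}_\tau(\pi)},$$ and define formal power series over $\mathbb Z[q]$ by $$A(x,u)=\sum_{n\ge0}\sum_{\ell\ge0}a^{(\ell)}(n)u^\ell x^n,\qquad A(x,u,v)=\sum_{n\ge a}\sum_{\ell\ge0}\sum_{i=1}^{n-a+1}a^{(\ell)}(n,i)u^\ell v^{i-1}x^n.$$ Let $y=\sum_{n\ge0}\sum_{\pi\in NC_n}q^{\mu_\tau(\pi)}x^n$. Then $y=A(x,0)$ and $$xy^2-y+1+(q-1)x^{a+m-2}y^{m-1}(y-1)=0.$$ More generally, let $J=\sum_{n\ge0}\sum_{\pi\in NC_n}v^{\mathrm{rep}(\pi)}q^{\mu_\tau(\pi)}x^n$. Then, in the field of fractions of $\mathbb Z[q][[x,u,v]]$ (where none of the denominators below vanishes), $J=vA(x,0,v)+\frac1{1-x}$ if $a=2$, and $$J=vA(x,0,v)+\frac1{1-x}+\frac{v^2x^aC_{a-1}-v^2x^2}{1-vx}+v\sum_{i=2}^{a-1}C_ix^i+(v-1)\sum_{n\ge2}\ \sum_{j=\max\{1,n-a+2\}}^{n-1}C_{n-j}v^jx^n$$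 if $a\ge3$. Here $$A(x,0,v)=\frac{(y-1)(A(x,vx)-y)}{v}-M(x,0,v)+\frac{(q-1)v^{m-1}x^{a+m-2}(y-1)}{1-vx},$$ and $A(x,u)$ (hence also $A(x,vx)$, by putting $u=vx$) is given explicitly in terms of $y$ by $$A(x,u)=\frac{x-u}{xy-u}\left(\frac{x^aC_{a-1}}{(1-u)(1-x)}+\frac{(1-q)x^{a-1}\bigl(u^m(1-x)-x^m(1-u)\bigr)(y-1)}{(1-u)(1-x)(x-u)}+\frac{x(y-1)}{x-u}A(x,x)-M(x,u,1)+L(x,u)\right),$$ $$A(x,x)=\frac{(q-1)x^{a-2}\bigl((xy)^m(1-x)-x^m(1-xy)\bigr)}{(1-x)(1-xy)}-M(x,xy,1)+\frac{x^aC_{a-1}}{(1-x)(1-xy)}+L(x,xy),$$ where $$L(x,u)=\frac1{1-u}\sum_{j=0}^{a-1}C_jx^j,\qquad M(x,u,v)=\begin{cases}0,&a=2,\\[2pt]\dfrac{x}{(1-u)(1-vx)}\displaystyle\sum_{j=0}^{a-3}\sum_{i=1}^{a-2-j}C_iC_jx^{i+j},&a\ge3.\end{cases}$$ -/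

import Mathlib

noncomputable section

namespace SubwordNC

open scoped Classical

/-! ### Non-crossing partitions through their canonical sequential forms -/

/-- The letter `π_i` of the canonical sequential form of a partition `P` of `{0, …, n-1}`: the
position (counted from 1) of the block of `i` when the blocks are listed by increasing minimum. -/
def letter {n : ℕ} (P : Finpartition (Finset.univ : Finset (Fin n))) (i : Fin n) : ℕ :=
  (P.parts.filter fun B => B.min ≤ (P.part i).min).card

/-- The canonical sequential form `π_1 ⋯ π_n`. -/
def word {n : ℕ} (P : Finpartition (Finset.univ : Finset (Fin n))) : List ℕ :=
  List.ofFn (letter P)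

/-- `P` is non-crossing: its canonical sequential form has no subsequence `c-d-c-d` with
`c < d`. -/
def NonCrossing {n : ℕ} (P : Finpartition (Finset.univ : Finset (Fin n))) : Prop :=
  ¬ ∃ i j k l : Fin n, i < j ∧ j < k ∧ k < l ∧
    letter P i = letter P k ∧ letter P j = letter P l ∧ letter P i < letter P j

/-- The set `NC_n` of non-crossing partitions of an `n`-element set. -/
def NC (n : ℕ) : Finset (Finpartition (Finset.univ : Finset (Fin n))) :=
  Finset.univ.filter NonCrossing

/-! ### Subword occurrences, and the smallest repeated letter -/

/-- Two words are order-isomorphic: same length and same relative order of the letters. -/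
def OrdIso (s t : List ℕ) : Prop :=
  s.length = t.length ∧ ∀ i j : ℕ, i < s.length → j < s.length →
    (s.getD i 0 < s.getD j 0 ↔ t.getD i 0 < t.getD j 0)

/-- The number of occurrences of `t` as a subword (string of consecutive letters) of `w`. -/
def occ (t w : List ℕ) : ℕ :=
  ((Finset.range (w.length + 1 - t.length)).filter
    fun i => OrdIso ((w.drop i).take t.length) t).card

/-- The pattern `12⋯(m-1)m^a`. -/
def pat (a m : ℕ) : List ℕ :=
  List.range' 1 (m - 1) ++ List.replicate a m

/-- The number of occurrences of the pattern `12⋯(m-1)m^a` in `12⋯ℓ(π+ℓ)`, where `π` is the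
canonical sequential form of `P`; for `ℓ = 0` this is the number of occurrences in `π`. -/
def mu (a m l : ℕ) {n : ℕ} (P : Finpartition (Finset.univ : Finset (Fin n))) : ℕ :=
  occ (pat a m) (List.range' 1 l ++ (word P).map (· + l))

/-- The smallest repeated letter of the canonical sequential form; it is `0` (the infimum of the
empty set of naturals) exactly for the increasing partition `12⋯n`. -/
def rep {n : ℕ} (P : Finpartition (Finset.univ : Finset (Fin n))) : ℕ :=
  sInf {c : ℕ | 2 ≤ (word P).count c}

/-- `a^{(ℓ)}(n)`, a polynomial in `q = Polynomial.X`. -/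
def cnt (a m l n : ℕ) : Polynomial ℤ :=
  ∑ P ∈ NC n, Polynomial.X ^ mu a m l P

/-- `a^{(ℓ)}(n, i)`, a polynomial in `q = Polynomial.X`. -/
def cntRep (a m l n i : ℕ) : Polynomial ℤ :=
  ∑ P ∈ (NC n).filter (fun P => rep P = i), Polynomial.X ^ mu a m l P

/-! ### Generating functions -/

/-- Formal power series over `ℤ[q]` in three variables `x`, `u`, `v` (indices `0`, `1`, `2`). -/
abbrev GF : Type := MvPowerSeries (Fin 3) (Polynomial ℤ)

/-- The fraction field, in which the formulas with denominators are read. -/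
abbrev Frac : Type := FractionRing GF

/-- The variable `x`. -/
def gx : GF := MvPowerSeries.X 0

/-- The variable `u`. -/
def gu : GF := MvPowerSeries.X 1

/-- The variable `v`. -/
def gv : GF := MvPowerSeries.X 2

/-- The element `q`. -/
def gq : GF := MvPowerSeries.C (Polynomial.X : Polynomial ℤ)

/-- The generating function `∑_n ∑_{π ∈ NC_n} q^{μ(π)} x^n`. -/
def ncGF (a m : ℕ) : GF := fun e =>
  if e 1 = 0 ∧ e 2 = 0 then ∑ P ∈ NC (e 0), Polynomial.X ^ occ (pat a m) (word P) else 0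

/-- The joint generating function `∑_n ∑_{π ∈ NC_n} v^{rep(π)} q^{μ(π)} x^n`. -/
def jointGF (a m : ℕ) : GF := fun e =>
  if e 1 = 0 then
    ∑ P ∈ (NC (e 0)).filter (fun P => rep P = e 2), Polynomial.X ^ occ (pat a m) (word P)
  else 0

/-- `A(x,u) = ∑_{n ≥ 0} ∑_{ℓ ≥ 0} a^{(ℓ)}(n) u^ℓ x^n`. -/
def A2 (a m : ℕ) : GF := fun e =>
  if e 2 = 0 then cnt a m (e 1) (e 0) else 0

/-- `A(x,u,v) = ∑_{n ≥ a} ∑_{ℓ ≥ 0} ∑_{i=1}^{n-a+1} a^{(ℓ)}(n,i) u^ℓ v^{i-1} x^n`. -/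
def A3 (a m : ℕ) : GF := fun e =>
  if a ≤ e 0 ∧ e 2 + 1 ≤ e 0 - a + 1 then cntRep a m (e 1) (e 0) (e 2 + 1) else 0

/-- `∑_{n ≥ 2} ∑_{j=r}^{n-1} C_{n-j} v^j x^n` with `r = max {1, n-a+2}`. -/
def tailGF (a : ℕ) : GF := fun e =>
  if e 1 = 0 ∧ 2 ≤ e 0 ∧ e 2 ∈ Finset.Icc (max 1 (e 0 + 2 - a)) (e 0 - 1) then
    (catalan (e 0 - e 2) : Polynomial ℤ)
  else 0

/-- Substitution of `s` (a series without constant term) for the variable `u`. -/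
def substU (s f : GF) : GF :=
  MvPowerSeries.subst (![gx, s, gv] : Fin 3 → GF) f

/-- The inclusion of power series in the fraction field. -/
def toFrac : GF →+* Frac := algebraMap GF Frac

/-! ### The explicit expressions of the formula -/

/-- `L(x,u)`. -/
def Lser {F : Type*} [Field F] (a : ℕ) (x u : F) : F :=
  1 / (1 - u) * ∑ j ∈ Finset.range a, (catalan j : F) * x ^ j

/-- `M(x,u,v)`, equal to `0` for `a = 2`. -/
def Mser {F : Type*} [Field F] (a : ℕ) (x u v : F) : F :=
  if a = 2 then 0 else
    x / ((1 - u) * (1 - v * x)) *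
      ∑ j ∈ Finset.range (a - 2), ∑ i ∈ Finset.Icc 1 (a - 2 - j),
        (catalan i : F) * (catalan j : F) * x ^ (i + j)

/-- The explicit expression for `A(x,x)` in terms of `x`, `q` and `y`. -/
def exprAxx {F : Type*} [Field F] (a m : ℕ) (q x y : F) : F :=
  (q - 1) * x ^ (a - 2) * ((x * y) ^ m * (1 - x) - x ^ m * (1 - x * y))
      / ((1 - x) * (1 - x * y))
    - Mser a x (x * y) 1
    + x ^ a * (catalan (a - 1) : F) / ((1 - x) * (1 - x * y))
    + Lser a x (x * y)

/-- The explicit expression for `A(x,u)` in terms of `x`, `u`, `q` and `y`. -/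
def exprA {F : Type*} [Field F] (a m : ℕ) (q x y u : F) : F :=
  (x - u) / (x * y - u) *
    (x ^ a * (catalan (a - 1) : F) / ((1 - u) * (1 - x))
      + (1 - q) * x ^ (a - 1) * (u ^ m * (1 - x) - x ^ m * (1 - u)) * (y - 1)
          / ((1 - u) * (1 - x) * (x - u))
      + x * (y - 1) / (x - u) * exprAxx a m q x y
      - Mser a x u 1
      + Lser a x u)

end SubwordNC

end

noncomputable section

namespace SubwordNC

open scoped Classical

/-! ### Subword occurrences in lists -/

/-! Cut a nonempty non-crossing word at the second occurrence of its letter 1. The letters in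
between form a non-crossing word shifted by 1; the rest begins with 1 and otherwise uses only new
letters, since an old letter `c` would give `1 c 1 c`. This recursion identifies non-crossing
partitions of size `n` with binary trees with `n` nodes (`toWord`, `image_word_NC`).

The cut is compatible with the pattern τ. Being weakly increasing, τ cannot straddle the descent
before the second 1, and a prefix `12⋯ℓ` followed by the first letter is a prefix of length `ℓ+1`
for the left part. If the left part is empty, the word begins `11` or is the single letter `1`, and
at most one occurrence starts in the prefix; it exists when `ℓ ≥ m-1` and the word begins with `a`
copies of 1. For F_ℓ = ∑ a^(ℓ)(n) x^n and y = F_0 this yields (`prefSer_eq`) F_ℓ = 1 + x y F_{ℓ+1} +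
[ℓ ≥ m-1] (q-1) x^{a-1} (y-1).

Summed against u^ℓ, this is a linear equation for A(x,u) with kernel u - xy (`gu_mul_A2`). Putting u
= xy kills the kernel and leaves the polynomial equation for y; u = x gives A(x,x); eliminating
between the equations at u and at x gives A(x,u), and the same with u = vx.

For the smallest repeated letter: it is 1 exactly when the right subtree is nonempty; otherwise it
comes from the left subtree, one level up and with a prefix longer by one. Hence the partitions with
`rep` equal to k+1 contribute x^k (F_k - 1 - x F_{k+1}), and those with `rep` equal to 0 contribute
1/(1-x). The truncation in A(x,0,v) only discards coefficients of degree below `a` of F_k - 1 - x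
F_{k+1}; there no τ fits, so they are differences of Catalan numbers, collected in `catDiff`. The
Catalan recurrence (`mul_sum_catalan`) identifies this loss with M. -/

theorem occ_nil {t : List ℕ} (ht : t ≠ []) : occ t [] = 0 := by
  have : 0 < t.length := List.length_pos_iff.2 ht
  have h : ([] : List ℕ).length + 1 - t.length = 0 := by simp; omega
  simp only [occ, h, Finset.range_zero, Finset.filter_empty, Finset.card_empty]

theorem OrdIso.length_eq {s t : List ℕ} (h : OrdIso s t) : s.length = t.length := h.1

theorem occ_cons {t : List ℕ} (c : ℕ) (w : List ℕ) :
    occ t (c :: w) = (if OrdIso ((c :: w).take t.length) t then 1 else 0) + occ t w := by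
  unfold occ
  by_cases hl : t.length ≤ w.length + 1
  · have h : (c :: w).length + 1 - t.length = (w.length + 1 - t.length) + 1 := by
      simp; omega
    rw [h, Finset.card_filter, Finset.sum_range_succ', Finset.card_filter, add_comm]
    simp
  · have h : (c :: w).length + 1 - t.length = 0 := by simp; omega
    have h' : w.length + 1 - t.length = 0 := by omega
    rw [h, h', if_neg]
    · simp
    · intro h
      have := h.length_eq
      simp at this
      omega

theorem ordIso_map_iff {f : ℕ → ℕ} (hf : StrictMono f) (s t : List ℕ) :
    OrdIso (s.map f) t ↔ OrdIso s t := by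
  unfold OrdIso
  simp only [List.length_map]
  refine and_congr_right fun _ => forall₂_congr fun i j => forall₂_congr fun hi hj => ?_
  rw [List.getD_eq_getElem _ _ (by simpa using hi), List.getD_eq_getElem _ _ (by simpa using hj),
    List.getD_eq_getElem _ _ hi, List.getD_eq_getElem _ _ hj, List.getElem_map, List.getElem_map,
    hf.lt_iff_lt]

theorem occ_map {f : ℕ → ℕ} (hf : StrictMono f) (t w : List ℕ) :
    occ t (w.map f) = occ t w := by
  simp only [occ, List.length_map, ← List.map_drop, ← List.map_take, ordIso_map_iff hf]

/-- Occurrences of a weakly increasing pattern do not cross a descent. -/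
theorem occ_append_of_descent {t : List ℕ} (ht : t ≠ [])
    (hmono : ∀ i j, i ≤ j → j < t.length → t.getD i 0 ≤ t.getD j 0)
    (u : List ℕ) (b d : ℕ) (hbd : d < b) (v : List ℕ) :
    occ t (u ++ b :: d :: v) = occ t (u ++ [b]) + occ t (d :: v) := by
  induction u with
  | nil =>
    rw [List.nil_append, List.nil_append, occ_cons, occ_cons b [], occ_nil ht]
    congr 1
    rw [add_zero]
    congr 1
    have hpos : 0 < t.length := List.length_pos_iff.2 ht
    -- A window of length at least 2 starting at `b` contains the descent, while the truncated word
    -- `[b]` is too short for it; a window of length 1 sees only `b`.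
    rcases Nat.lt_or_ge 1 t.length with h1 | h1
    · refine propext ⟨fun h => ?_, fun h => ?_⟩
      · exfalso
        have hl := h.1
        have := (h.2 1 0 (by omega) (by omega)).1 (by
          obtain ⟨k, hk⟩ : ∃ k, t.length = k + 2 := ⟨t.length - 2, by omega⟩
          rw [hk]; simpa using hbd)
        have := hmono 0 1 (by omega) h1
        omega
      · have hl := h.1
        simp at hl; omega
    · obtain h1 : t.length = 1 := by omega
      rw [h1]; simp
  | cons c u ih =>
    rw [List.cons_append, List.cons_append, occ_cons, occ_cons c (u ++ [b]), ih, add_assoc]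
    congr 2
    -- `d` sits at index `u.length + 2`: either the window reaches it and contains the descent, or
    -- it lies entirely within `c :: (u ++ [b])`.
    rcases Nat.lt_or_ge (u.length + 2) t.length with h1 | h1
    · refine propext ⟨fun h => ?_, fun h => ?_⟩
      · exfalso
        have hl := h.1
        have := (h.2 (u.length + 2) (u.length + 1) (by omega) (by omega)).1 (by
          rw [List.getD_eq_getElem _ _ (by omega), List.getD_eq_getElem _ _ (by omega),
            List.getElem_take, List.getElem_take]
          simpa [List.getElem_append] using hbd)
        have := hmono (u.length + 1) (u.length + 2) (by omega) h1
        omega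
      · have hl := h.1
        simp at hl; omega
    · have : c :: (u ++ b :: d :: v) = (c :: (u ++ [b])) ++ (d :: v) := by simp
      rw [this, List.take_append_of_le_length (by simp; omega)]

/-! ### The pattern `12⋯(m-1)m^a` -/

theorem length_pat {a m : ℕ} (hm : 2 ≤ m) : (pat a m).length = a + m - 1 := by
  simp [pat]; omega

theorem pat_ne_nil {a m : ℕ} (hm : 2 ≤ m) : pat a m ≠ [] := by
  rw [← List.length_pos_iff, length_pat hm]; omega

/-- Reduces comparisons of pattern letters to linear arithmetic with `min`. -/
theorem getD_pat {a m : ℕ} (hm : 2 ≤ m) {i : ℕ} (hi : i < a + m - 1) :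
    (pat a m).getD i 0 = min (i + 1) m := by
  rw [List.getD_eq_getElem _ _ (by rw [length_pat hm]; exact hi)]
  unfold pat
  rw [List.getElem_append]
  split_ifs with h
  · simp at h ⊢; omega
  · simp at h ⊢; omega

theorem pat_mono {a m : ℕ} (hm : 2 ≤ m) (i j : ℕ) (hij : i ≤ j) (hj : j < (pat a m).length) :
    (pat a m).getD i 0 ≤ (pat a m).getD j 0 := by
  rw [length_pat hm] at hj
  rw [getD_pat hm hj, getD_pat hm (hij.trans_lt hj)]
  omega

/-- As `m ≥ 2`, the pattern opens with a strict ascent, so nothing starts at the first of two equal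
letters. -/
theorem occ_pat_cons_self {a m : ℕ} (ha : 2 ≤ a) (hm : 2 ≤ m) (c : ℕ) (w : List ℕ) :
    occ (pat a m) (c :: c :: w) = occ (pat a m) (c :: w) := by
  rw [occ_cons, if_neg, zero_add]
  intro h
  have hl := h.1
  rw [length_pat hm] at h hl
  have := (h.2 0 1 (by omega) (by omega)).2 (by
    rw [getD_pat hm (by omega), getD_pat hm (by omega)]; omega)
  obtain ⟨k, hk⟩ : ∃ k, a + m - 1 = k + 2 := ⟨a + m - 1 - 2, by omega⟩
  rw [hk] at this
  simp at this

/-- The pattern starts at the beginning of `s(s+1)⋯(s+ℓ-1)w`, where `w` starts with a repeated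
letter `s+ℓ`, exactly if `ℓ = m - 1` and `w` starts with `a` copies of that letter. -/
theorem ordIso_take_range'_append {a m : ℕ} (ha : 2 ≤ a) (hm : 2 ≤ m) (s l : ℕ) (hl : 1 ≤ l)
    (w : List ℕ) :
    OrdIso ((List.range' s l ++ (s + l) :: (s + l) :: w).take (pat a m).length) (pat a m) ↔
      l = m - 1 ∧ List.replicate a (s + l) <+: (s + l) :: (s + l) :: w := by
  rw [length_pat hm]
  set W := List.range' s l ++ (s + l) :: (s + l) :: w with hW
  have hlen : W.length = l + (w.length + 2) := by simp [hW]
  have g1 : ∀ i, i ≤ l → W.getD i 0 = s + i := by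
    intro i hi
    rw [List.getD_eq_getElem _ _ (by omega)]
    simp only [hW, List.getElem_append]
    split_ifs with h
    · simp
    · have : i = l := by simp at h; omega
      subst this; simp
  have g2 : W.getD (l + 1) 0 = s + l := by
    rw [List.getD_eq_getElem _ _ (by omega)]
    simp [hW]
  have gt : ∀ i, i < a + m - 1 → (W.take (a + m - 1)).getD i 0 = W.getD i 0 := by
    intro i hi
    simp [List.getD_eq_getElem?_getD, hi]
  constructor
  · intro h
    have hl' := h.1
    rw [length_pat hm] at hl'
    have key : ∀ i j, i < a + m - 1 → j < a + m - 1 →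
        (W.getD i 0 < W.getD j 0 ↔ min (i + 1) m < min (j + 1) m) := by
      intro i j hi hj
      have := h.2 i j (by omega) (by omega)
      rwa [gt i hi, gt j hj, getD_pat hm hi, getD_pat hm hj] at this
    have hlm : l = m - 1 := by
      -- If `l` is too small, the repetition at positions `l`, `l + 1` falls where the pattern still
      -- rises; if too large, the word still rises between positions `m - 1` and `m`, where the
      -- pattern is constant.
      rcases Nat.lt_trichotomy l (m - 1) with h1 | h1 | h1
      · have := (key l (l + 1) (by omega) (by omega)).2 (by omega)
        rw [g1 l le_rfl, g2] at this; omega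
      · exact h1
      · have := (key (m - 1) m (by omega) (by omega)).1 (by
          rw [g1 _ (by omega), g1 _ (by omega)]; omega)
        omega
    refine ⟨hlm, ?_⟩
    have hWl : a + m - 1 ≤ W.length := by
      simp at hl'; omega
    rw [List.prefix_iff_eq_take, List.length_replicate]
    refine List.ext_getElem (by simp; omega) fun i h1 h2 => ?_
    simp only [List.length_replicate] at h1
    simp only [List.getElem_replicate, List.getElem_take]
    have k1 := key (l + i) l (by omega) (by omega)
    have k2 := key l (l + i) (by omega) (by omega)
    have : W.getD (l + i) 0 = ((s + l) :: (s + l) :: w)[i]'(by simp; omega) := by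
      rw [List.getD_eq_getElem _ _ (by omega)]
      simp [hW]
    rw [this, g1 l le_rfl] at k1 k2
    omega
  · rintro ⟨rfl, v, hv⟩
    have : W.take (a + m - 1) = (pat a m).map (· + s - 1) := by
      rw [hW, ← hv, ← List.append_assoc, List.take_left' (by simp; omega)]
      unfold pat
      refine List.ext_getElem (by simp) fun i h1 h2 => ?_
      rw [List.getElem_map, List.getElem_append, List.getElem_append]
      simp only [List.length_range']
      split_ifs
      · simp; omega
      · simp; omega
    refine ⟨by rw [this]; simp, fun i j hi hj => ?_⟩
    rw [this, List.length_map, length_pat hm] at hi hj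
    have e : ∀ i, i < a + m - 1 → (W.take (a + m - 1)).getD i 0 = min (i + 1) m + s - 1 := by
      intro i hi
      rw [this, List.getD_eq_getElem _ _ (by simpa [length_pat hm] using hi), List.getElem_map,
        ← getD_pat hm hi, List.getD_eq_getElem _ _ (by simpa [length_pat hm] using hi)]
    rw [e i hi, e j hj, getD_pat hm hi, getD_pat hm hj]
    omega

/-- Strip the prefix letter by letter: a start inside it succeeds only when exactly `m - 1` prefix
letters remain, so at most once. -/
theorem occ_pat_range'_append {a m : ℕ} (ha : 2 ≤ a) (hm : 2 ≤ m) (s l : ℕ) (w : List ℕ) :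
    occ (pat a m) (List.range' s l ++ (s + l) :: (s + l) :: w) =
      occ (pat a m) ((s + l) :: (s + l) :: w) +
        if m - 1 ≤ l ∧ List.replicate a (s + l) <+: (s + l) :: (s + l) :: w then 1 else 0 := by
  induction l generalizing s with
  | zero => simp; omega
  | succ l ih =>
    have := ih (s + 1)
    rw [show s + 1 + l = s + (l + 1) by ring] at this
    rw [List.range'_succ, List.cons_append, occ_cons, this, ← List.cons_append,
      ← List.range'_succ, if_congr (ordIso_take_range'_append ha hm s (l + 1) (by omega) w) rfl rfl]
    by_cases hp : List.replicate a (s + (l + 1)) <+: (s + (l + 1)) :: (s + (l + 1)) :: w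
    · simp only [hp, and_true]
      split_ifs <;> omega
    · simp [hp]

theorem occ_pat_range' {a m : ℕ} (ha : 2 ≤ a) (hm : 2 ≤ m) (s l : ℕ) :
    occ (pat a m) (List.range' s l) = 0 := by
  unfold occ
  rw [Finset.card_eq_zero, Finset.filter_eq_empty_iff]
  intro i hi h
  have hl := h.1
  rw [length_pat hm] at h hl
  have := (h.2 (m - 1) m (by omega) (by omega)).1 (by
    rw [List.getD_eq_getElem _ _ (by omega), List.getD_eq_getElem _ _ (by omega)]
    simp; omega)
  rw [getD_pat hm (by omega), getD_pat hm (by omega)] at this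
  omega

section

/-! ### Restricted growth words -/

/-- The largest of `k` and the letters of `w`. -/
def maxLetter (k : ℕ) (w : List ℕ) : ℕ := w.foldl max k

@[simp] theorem maxLetter_nil (k : ℕ) : maxLetter k [] = k := rfl

@[simp] theorem maxLetter_cons (k c : ℕ) (w : List ℕ) :
    maxLetter k (c :: w) = maxLetter (max k c) w := rfl

/-- `w` continues a restricted growth word whose largest letter is `k`. -/
def RGFrom : ℕ → List ℕ → Prop
  | _, [] => True
  | k, c :: w => 1 ≤ c ∧ c ≤ k + 1 ∧ RGFrom (max k c) w

/-- `w` has no subsequence `c-d-c-d` with `c < d`. -/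
def NCWord (w : List ℕ) : Prop := ∀ c d, c < d → ¬ [c, d, c, d].Sublist w

theorem NCWord.mono {w w' : List ℕ} (h : NCWord w) (hs : w'.Sublist w) : NCWord w' :=
  fun c d hcd h' => h c d hcd (h'.trans hs)

theorem NCWord.of_map {f : ℕ → ℕ} (hf : StrictMono f) {w : List ℕ} (h : NCWord (w.map f)) :
    NCWord w :=
  fun c d hcd h' => h (f c) (f d) (hf hcd) (by simpa using h'.map f)

theorem NCWord.map {f : ℕ → ℕ} (hf : StrictMono f) {w : List ℕ} (h : NCWord w) :
    NCWord (w.map f) := by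
  intro c d hcd h'
  obtain ⟨l, hl, he⟩ := List.sublist_map_iff.1 h'
  obtain _ | ⟨x, _ | ⟨y, _ | ⟨z, _ | ⟨t, _ | ⟨_, _⟩⟩⟩⟩⟩ := l <;>
    simp only [List.map_cons, List.map_nil, List.cons.injEq, and_true, reduceCtorEq,
      and_false] at he
  obtain ⟨rfl, rfl, h1, h2⟩ := he
  rw [← hf.injective h1, ← hf.injective h2] at hl
  exact h x y (hf.lt_iff_lt.1 hcd) hl

theorem RGFrom_append (k : ℕ) (u v : List ℕ) :
    RGFrom k (u ++ v) ↔ RGFrom k u ∧ RGFrom (maxLetter k u) v := by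
  induction u generalizing k with
  | nil => simp [RGFrom]
  | cons c u ih => simp [RGFrom, ih, and_assoc]

theorem le_maxLetter (k : ℕ) (w : List ℕ) : k ≤ maxLetter k w := by
  induction w generalizing k with
  | nil => simp
  | cons c w ih => exact (le_max_left _ _).trans (ih _)

theorem le_maxLetter_of_mem {k c : ℕ} {w : List ℕ} (h : c ∈ w) : c ≤ maxLetter k w := by
  induction w generalizing k with
  | nil => simp at h
  | cons d w ih =>
    rcases List.mem_cons.1 h with rfl | h
    · exact (le_max_right _ _).trans (le_maxLetter _ _)
    · exact ih h

theorem RGFrom.one_le {k c : ℕ} {w : List ℕ} (hw : RGFrom k w) (h : c ∈ w) : 1 ≤ c := by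
  induction w generalizing k with
  | nil => simp at h
  | cons d w ih =>
    rcases List.mem_cons.1 h with rfl | h
    · exact hw.1
    · exact ih hw.2.2 h

theorem RGFrom.mem_of_le {k c : ℕ} {w : List ℕ} (hw : RGFrom k w) (h : c ≤ maxLetter k w) :
    c ≤ k ∨ c ∈ w := by
  induction w generalizing k with
  | nil => exact .inl h
  | cons d w ih =>
    obtain ⟨_, h2, h3⟩ := hw
    rcases ih h3 h with h | h
    · rcases le_or_gt c k with h' | h'
      · exact .inl h'
      · have : c = d := by omega
        simp [this]
    · simp [h]

/-- Replaces the running maximum by the positional condition that smaller values occur earlier,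
which is the form available for partitions. -/
theorem RGFrom_iff_forall_append (k : ℕ) (w : List ℕ) :
    RGFrom k w ↔ ∀ p c s, w = p ++ c :: s → 1 ≤ c ∧ ∀ d, d < c → d ≤ k ∨ d ∈ p := by
  constructor
  · rintro h p c s rfl
    rw [RGFrom_append] at h
    obtain ⟨h1, h2, h3, -⟩ := h
    exact ⟨h2, fun d hd => h1.mem_of_le (by omega)⟩
  · induction w generalizing k with
    | nil => simp [RGFrom]
    | cons c w ih =>
      intro h
      obtain ⟨h1, h2⟩ := h [] c w rfl
      refine ⟨h1, ?_, ih _ ?_⟩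
      · have := h2 (c - 1) (by omega)
        simp at this; omega
      · rintro p d s rfl
        obtain ⟨h3, h4⟩ := h (c :: p) d s rfl
        refine ⟨h3, fun e he => ?_⟩
        rcases h4 e he with h5 | h5
        · left; omega
        · rcases List.mem_cons.1 h5 with rfl | h5
          · left; omega
          · exact .inr h5

theorem maxLetter_map_add (k j : ℕ) (w : List ℕ) :
    maxLetter (k + j) (w.map (· + j)) = maxLetter k w + j := by
  induction w generalizing k with
  | nil => simp
  | cons c w ih =>
    rw [List.map_cons, maxLetter_cons, maxLetter_cons, ← ih]
    congr 1; omega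

theorem RGFrom_map_succ (k : ℕ) (w : List ℕ) (h : ∀ c ∈ w, 1 ≤ c) :
    RGFrom (k + 1) (w.map (· + 1)) ↔ RGFrom k w := by
  induction w generalizing k with
  | nil => simp [RGFrom]
  | cons c w ih =>
    have : max (k + 1) (c + 1) = max k c + 1 := by omega
    simp only [List.map_cons, RGFrom, this, ih _ fun d hd => h d (by simp [hd])]
    have := h c (by simp)
    refine and_congr (by omega) (and_congr (by omega) Iff.rfl)

/-- The map which fixes `0` and `1` and adds `K` to all other letters. -/
def lift (K c : ℕ) : ℕ := if c ≤ 1 then c else c + K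

theorem lift_strictMono (K : ℕ) : StrictMono (lift K) := by
  intro c d h
  unfold lift
  split_ifs <;> omega

@[simp] theorem lift_one (K : ℕ) : lift K 1 = 1 := rfl

/-- Once `k ≥ 1`, the fixed letter 1 never raises the maximum, so the lift moves every new maximum
by exactly `K`. -/
theorem RGFrom_map_lift (K k : ℕ) (hk : 1 ≤ k) (w : List ℕ) :
    RGFrom (k + K) (w.map (lift K)) ↔ RGFrom k w := by
  induction w generalizing k with
  | nil => simp [RGFrom]
  | cons c w ih =>
    have : max (k + K) (lift K c) = max k c + K := by unfold lift; split_ifs <;> omega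
    simp only [List.map_cons, RGFrom, this, ih _ (hk.trans (le_max_left k c))]
    unfold lift
    refine and_congr (by split_ifs <;> omega) (and_congr (by split_ifs <;> omega) Iff.rfl)

theorem RGFrom_zero_cons_iff {c : ℕ} {w : List ℕ} :
    RGFrom 0 (c :: w) ↔ c = 1 ∧ RGFrom 1 w := by
  constructor
  · rintro ⟨h1, h2, h3⟩
    obtain rfl : c = 1 := by omega
    exact ⟨rfl, h3⟩
  · rintro ⟨rfl, h⟩
    exact ⟨le_rfl, by omega, h⟩

/-! ### Words of binary trees -/

open BinaryTree

/-- The non-crossing word of a binary tree. The left subtree carries the letters between the first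
two occurrences of `1`, the right subtree carries the rest, its letter `1` being the overall `1`. -/
def toWord : BinaryTree Unit → List ℕ
  | nil => []
  | node _ s t =>
    1 :: ((toWord s).map (· + 1) ++ (toWord t).map (lift (maxLetter 0 (toWord s))))

@[simp] theorem toWord_nil : toWord nil = [] := rfl

theorem toWord_node (i : Unit) (s t : BinaryTree Unit) : toWord (node i s t) =
    1 :: ((toWord s).map (· + 1) ++ (toWord t).map (lift (maxLetter 0 (toWord s)))) := rfl

theorem length_toWord (t : BinaryTree Unit) : (toWord t).length = t.numNodes := by
  induction t with
  | nil => rfl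
  | node i s t hs ht => simp [toWord_node, hs, ht]

theorem toWord_eq_nil_iff {t : BinaryTree Unit} : toWord t = [] ↔ t = nil := by
  cases t <;> simp [toWord_node]

theorem toWord_rgFrom (t : BinaryTree Unit) : RGFrom 0 (toWord t) := by
  induction t with
  | nil => trivial
  | node i s t hs ht =>
    rw [toWord_node, RGFrom_zero_cons_iff, RGFrom_append]
    refine ⟨rfl, (RGFrom_map_succ 0 _ fun c hc => hs.one_le hc).2 hs, ?_⟩
    have := maxLetter_map_add 0 1 (toWord s)
    rw [zero_add] at this
    -- After the left part the maximum is one more than that of the left word; undoing the lift, the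
    -- right word only has to continue from maximum 1.
    rw [this, add_comm, RGFrom_map_lift _ _ le_rfl]
    cases h : toWord t with
    | nil => trivial
    | cons c w =>
      rw [h, RGFrom_zero_cons_iff] at ht
      obtain ⟨rfl, ht⟩ := ht
      exact ⟨le_rfl, by omega, ht⟩

theorem one_le_of_mem_toWord {t : BinaryTree Unit} {c : ℕ} (h : c ∈ toWord t) : 1 ≤ c :=
  (toWord_rgFrom t).one_le h

theorem toWord_eq_cons {t : BinaryTree Unit} (h : t ≠ nil) : ∃ w, toWord t = 1 :: w := by
  cases t with
  | nil => exact absurd rfl h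
  | node i s t => exact ⟨_, rfl⟩

/-- With `K` the maximum of the left word, its shifted letters lie in `2, …, K+1`, whereas the
lifted letters other than 1 are at least `K+2`. -/
theorem eq_one_of_mem_of_mem {s t : BinaryTree Unit} {c : ℕ}
    (hs : c ∈ 1 :: (toWord s).map (· + 1))
    (ht : c ∈ (toWord t).map (lift (maxLetter 0 (toWord s)))) : c = 1 := by
  rcases List.mem_cons.1 hs with h | h
  · exact h
  · obtain ⟨d, hd, rfl⟩ := List.mem_map.1 h
    obtain ⟨e, he, h2⟩ := List.mem_map.1 ht
    have := le_maxLetter_of_mem (k := 0) hd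
    have := one_le_of_mem_toWord hd
    have := one_le_of_mem_toWord he
    unfold lift at h2
    split_ifs at h2 <;> omega

/-- The junction of the two parts cuts `c d c d` somewhere, and a letter on both sides must be 1.
After two or three letters this forces `d = 1 ≤ c`. After one letter, `c = 1`; as the right part
itself begins with 1, it already contains the whole pattern. Otherwise the pattern lies in one part.
-/
theorem toWord_ncWord (t : BinaryTree Unit) : NCWord (toWord t) := by
  induction t with
  | nil => intro c d _ h; simp at h
  | node i s t hs ht =>
    intro c d hcd h
    rw [toWord_node, ← List.cons_append, List.sublist_append_iff] at h
    set K := maxLetter 0 (toWord s) with hK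
    have hc : c ∈ toWord (node i s t) → 1 ≤ c := one_le_of_mem_toWord
    rw [toWord_node, ← List.cons_append, List.mem_append] at hc
    obtain ⟨l₁, l₂, he, h1, h2⟩ := h
    match l₁, he with
    | [], he =>
      obtain rfl : [c, d, c, d] = l₂ := by simpa using he
      exact ht.map (lift_strictMono K) c d hcd h2
    | [x], he =>
      simp only [List.cons_append, List.nil_append, List.cons.injEq] at he
      obtain ⟨rfl, rfl⟩ := he
      obtain rfl : c = 1 := eq_one_of_mem_of_mem (by simpa using h1)
        (h2.subset (by simp))
      have htn : t ≠ nil := by rintro rfl; simp at h2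
      obtain ⟨w, hw⟩ := toWord_eq_cons htn
      have h3 := ht.map (lift_strictMono K) 1 d hcd
      rw [hw, List.map_cons, lift_one] at h2 h3
      refine h3 (List.Sublist.cons_cons _ ?_)
      cases h2 with
      | cons _ h => exact h
      | cons_cons _ h => omega
    | [x, y], he =>
      simp only [List.cons_append, List.nil_append, List.cons.injEq] at he
      obtain ⟨rfl, rfl, rfl⟩ := he
      have := eq_one_of_mem_of_mem (h1.subset (by simp : d ∈ [c, d])) (h2.subset (by simp))
      have := hc (.inl (h1.subset (by simp)))
      omega
    | [x, y, z], he =>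
      simp only [List.cons_append, List.nil_append, List.cons.injEq] at he
      obtain ⟨rfl, rfl, rfl, rfl⟩ := he
      have := eq_one_of_mem_of_mem (h1.subset (by simp : d ∈ [c, d, c])) (h2.subset (by simp))
      have := hc (.inl (h1.subset (by simp)))
      omega
    | x :: y :: z :: u :: l, he =>
      simp only [List.cons_append, List.cons.injEq] at he
      obtain ⟨rfl, rfl, rfl, rfl, he⟩ := he
      have hl : l = [] := by
        cases l with
        | nil => rfl
        | cons a b => simp at he
      subst hl
      have hc1 := hc (.inl (h1.subset (by simp)))
      cases h1 with
      | cons _ h => exact hs.map (f := (· + 1)) (fun a b h => Nat.add_lt_add_right h 1) c d hcd h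
      | cons_cons _ h =>
        have : 1 ∈ (toWord s).map (· + 1) := h.subset (by simp)
        obtain ⟨e, he, h⟩ := List.mem_map.1 this
        have := one_le_of_mem_toWord he
        omega

/-- The left subtree is recovered from the stretch between the initial 1 and the next 1; its maximum
then determines the lift to undo on the right. -/
theorem toWord_injective : Function.Injective toWord := by
  intro s
  induction s with
  | nil =>
    intro t h
    exact (toWord_eq_nil_iff.1 h.symm).symm
  | node i s t hs ht =>
    intro r h
    cases r with
    | nil => simp [toWord_node] at h
    | node j s' t' =>
      rw [toWord_node, toWord_node, List.cons.injEq] at h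
      have key : ∀ s t : BinaryTree Unit, ∀ K,
          ((toWord s).map (· + 1) ++ (toWord t).map (lift K)).takeWhile (fun c => c ≠ 1) =
            (toWord s).map (· + 1) := by
        intro s t K
        rw [List.takeWhile_append_of_pos]
        · rw [List.append_right_eq_self]
          by_cases hn : t = nil
          · simp [hn]
          · obtain ⟨w, hw⟩ := toWord_eq_cons hn
            simp [hw]
        · intro c hc
          obtain ⟨d, hd, rfl⟩ := List.mem_map.1 hc
          have := one_le_of_mem_toWord hd
          simp; omega
      have h1 := congrArg (List.takeWhile (fun c => c ≠ 1)) h.2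
      rw [key, key] at h1
      have h2 : s = s' := hs (List.map_injective_iff.2 (fun a b h => by simpa using h) h1)
      subst h2
      have h3 := List.append_cancel_left h.2
      have h4 : t = t' := ht (List.map_injective_iff.2 (lift_strictMono _).injective h3)
      rw [h4]

/-- Inverse construction: `p` is the stretch before the second 1 and `r` the rest; both become
canonical after renaming their letters. -/
theorem exists_toWord_eq (n : ℕ) (w : List ℕ) (hn : w.length = n) (hw : RGFrom 0 w)
    (hnc : NCWord w) : ∃ t, toWord t = w := by
  induction n using Nat.strong_induction_on generalizing w with
  | _ n ih =>
  cases w with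
  | nil => exact ⟨nil, rfl⟩
  | cons c w =>
  replace hw := RGFrom_zero_cons_iff.1 hw
  obtain ⟨rfl, hw⟩ := hw
  set p := w.takeWhile (fun c => c ≠ 1) with hp
  set r := w.dropWhile (fun c => c ≠ 1) with hr
  have hpr : w = p ++ r := (List.takeWhile_append_dropWhile ..).symm
  clear_value r
  have hp1 : ∀ c ∈ p, c ≠ 1 := fun c hc => by simpa using List.mem_takeWhile_imp hc
  have hr1 : r ≠ [] → ∃ r', r = 1 :: r' := by
    intro h
    have := List.head_dropWhile_not (fun c : ℕ => decide (c ≠ 1)) (l := w) (by rwa [← hr])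
    simp only [← hr] at this
    obtain ⟨d, r', rfl⟩ := List.exists_cons_of_ne_nil h
    have hd : d = 1 := not_not.1 (of_decide_eq_false this)
    exact ⟨r', by rw [hd]⟩
  clear_value p
  subst hpr
  rw [RGFrom_append] at hw
  have hp2 : ∀ c ∈ p, 2 ≤ c := fun c hc => by
    have := hw.1.one_le hc
    have := hp1 c hc
    omega
  have hpα : p = (p.map (· - 1)).map (· + 1) := by
    rw [List.map_map]
    refine (List.map_id p).symm.trans (List.map_congr_left fun c hc => ?_)
    have := hp2 c hc
    simp; omega
  set α := p.map (· - 1) with hα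
  have hα1 : ∀ c ∈ α, 1 ≤ c := by
    intro c hc
    obtain ⟨d, hd, rfl⟩ := List.mem_map.1 hc
    have := hp2 d hd
    omega
  obtain ⟨s, hs⟩ := ih α.length (by simp at hn; simp [hα]; omega) α rfl
    ((RGFrom_map_succ 0 α hα1).1 (hpα ▸ hw.1))
    (NCWord.of_map (f := (· + 1)) (fun a b h => Nat.add_lt_add_right h 1) (by
      rw [← hpα]; exact hnc.mono ((List.sublist_append_left p r).cons 1)))
  have hmx : maxLetter 1 p = maxLetter 0 α + 1 := by
    conv_lhs => rw [hpα]
    exact maxLetter_map_add 0 1 α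
  by_cases hr0 : r = []
  · refine ⟨node () s nil, ?_⟩
    simp [toWord_node, hr0, hs, ← hpα]
  obtain ⟨r', rfl⟩ := hr1 hr0
  set K := maxLetter 0 α with hK
  -- The only use of non-crossing across the cut: restricted growth puts any `c ≤ K + 1` other than
  -- 1 in `p`, and then `1 c 1 c` appears.
  have hbig : ∀ c ∈ r', c ≠ 1 → K + 1 < c := by
    intro c hc h1
    by_contra! hle
    rcases hw.1.mem_of_le (hmx ▸ hle) with h | h
    · have := hw.2.one_le (List.mem_cons_of_mem 1 hc)
      omega
    · have h2 := hw.1.one_le h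
      refine hnc 1 c (by omega) (List.Sublist.cons_cons 1 ?_)
      exact (List.singleton_sublist.2 h).append
        (List.Sublist.cons_cons 1 (List.singleton_sublist.2 hc))
  set β := (1 :: r').map (fun c => if c ≤ 1 then c else c - K) with hβ
  have hrβ : 1 :: r' = β.map (lift K) := by
    rw [hβ, List.map_map]
    refine (List.map_id _).symm.trans (List.map_congr_left fun c hc => ?_)
    have h1 := hw.2.one_le hc
    rcases List.mem_cons.1 hc with rfl | hc
    · simp [lift]
    · by_cases h : c = 1
      · simp [lift, h]
      · have := hbig c hc h
        simp only [id, Function.comp, lift]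
        rw [if_neg (show ¬ c ≤ 1 by omega), if_neg (by omega)]
        omega
  have hβ1 : ∃ β', β = 1 :: β' := ⟨_, rfl⟩
  obtain ⟨t, ht⟩ := ih β.length (by simp at hn; simp [hβ]; omega) β rfl
    (by
      have h2 := hw.2
      rw [hrβ, hmx, add_comm, RGFrom_map_lift _ _ le_rfl] at h2
      obtain ⟨β', hβ'⟩ := hβ1
      rw [hβ'] at h2 ⊢
      exact RGFrom_zero_cons_iff.2 ⟨rfl, h2.2.2⟩)
    (NCWord.of_map (lift_strictMono K) (by
      rw [← hrβ]; exact hnc.mono ((List.sublist_append_right p _).cons 1)))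
  refine ⟨node () s t, ?_⟩
  rw [toWord_node, hs, ht, ← hrβ, ← hpα]

end

/-! ### Canonical sequential forms -/

section Partition

variable {n : ℕ}

theorem parts_min_injOn (P : Finpartition (Finset.univ : Finset (Fin n))) {B B' : Finset (Fin n)}
    (hB : B ∈ P.parts) (hB' : B' ∈ P.parts) (h : B.min = B'.min) : B = B' := by
  obtain ⟨x, hx⟩ := Finset.min_of_nonempty (P.nonempty_of_mem_parts hB)
  have h1 := Finset.mem_of_min hx
  have h2 := Finset.mem_of_min (h ▸ hx)
  rw [← P.part_eq_of_mem hB h1, P.part_eq_of_mem hB' h2]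

/-- The position of a block when the blocks are listed by increasing minimum. -/
def blockRank (P : Finpartition (Finset.univ : Finset (Fin n))) (B : Finset (Fin n)) : ℕ :=
  (P.parts.filter fun B' => B'.min ≤ B.min).card

theorem letter_eq_blockRank (P : Finpartition (Finset.univ : Finset (Fin n))) (i : Fin n) :
    letter P i = blockRank P (P.part i) := rfl

theorem blockRank_lt {P : Finpartition (Finset.univ : Finset (Fin n))} {B B' : Finset (Fin n)}
    (hB' : B' ∈ P.parts) (h : B.min < B'.min) : blockRank P B < blockRank P B' := by
  refine Finset.card_lt_card (Finset.ssubset_iff_of_subset ?_ |>.2 ⟨B', ?_, ?_⟩)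
  · intro C hC
    simp only [Finset.mem_filter] at hC ⊢
    exact ⟨hC.1, hC.2.trans h.le⟩
  · exact Finset.mem_filter.2 ⟨hB', le_rfl⟩
  · exact fun hm => (Finset.mem_filter.1 hm).2.not_gt h

theorem blockRank_injOn {P : Finpartition (Finset.univ : Finset (Fin n))} {B B' : Finset (Fin n)}
    (hB : B ∈ P.parts) (hB' : B' ∈ P.parts) (h : blockRank P B = blockRank P B') : B = B' := by
  rcases lt_trichotomy B.min B'.min with h1 | h1 | h1
  · exact absurd h (blockRank_lt hB' h1).ne
  · exact parts_min_injOn P hB hB' h1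
  · exact absurd h (blockRank_lt hB h1).ne'

theorem letter_eq_letter_iff (P : Finpartition (Finset.univ : Finset (Fin n))) (i j : Fin n) :
    letter P i = letter P j ↔ P.part i = P.part j := by
  refine ⟨fun h => blockRank_injOn (P.part_mem.2 (Finset.mem_univ _))
    (P.part_mem.2 (Finset.mem_univ _)) h, fun h => ?_⟩
  rw [letter_eq_blockRank, letter_eq_blockRank, h]

/-- Ranks are injective with values between 1 and the number of blocks, so counting gives
surjectivity. -/
theorem image_blockRank (P : Finpartition (Finset.univ : Finset (Fin n))) :
    P.parts.image (blockRank P) = Finset.Icc 1 P.parts.card := by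
  refine Finset.eq_of_subset_of_card_le ?_ ?_
  · intro r hr
    obtain ⟨B, hB, rfl⟩ := Finset.mem_image.1 hr
    exact Finset.mem_Icc.2 ⟨Finset.card_pos.2 ⟨B, Finset.mem_filter.2 ⟨hB, le_rfl⟩⟩,
      Finset.card_le_card (Finset.filter_subset _ _)⟩
  · rw [Finset.card_image_of_injOn fun B hB B' hB' h => blockRank_injOn hB hB' h]
    simp

/-- Restricted growth functions: every value is positive, and all smaller positive values occur
earlier. -/
def IsRGFun (f : Fin n → ℕ) : Prop :=
  ∀ i, 1 ≤ f i ∧ ∀ d, 1 ≤ d → d < f i → ∃ j, j < i ∧ f j = d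

/-- A smaller value `d` is taken earlier at the minimum of the block of rank `d`, which precedes the
minimum of the block of `i`. -/
theorem isRGFun_letter (P : Finpartition (Finset.univ : Finset (Fin n))) :
    IsRGFun (letter P) := by
  intro i
  have hi : P.part i ∈ P.parts := P.part_mem.2 (Finset.mem_univ i)
  have h1 : blockRank P (P.part i) ∈ Finset.Icc 1 P.parts.card := by
    rw [← image_blockRank]; exact Finset.mem_image_of_mem _ hi
  rw [Finset.mem_Icc] at h1
  refine ⟨h1.1, fun d hd hlt => ?_⟩
  have h2 : d ∈ P.parts.image (blockRank P) := by
    rw [image_blockRank, Finset.mem_Icc]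
    rw [letter_eq_blockRank] at hlt
    omega
  obtain ⟨B, hB, rfl⟩ := Finset.mem_image.1 h2
  obtain ⟨j, hj⟩ := Finset.min_of_nonempty (P.nonempty_of_mem_parts hB)
  have hjB : P.part j = B := P.part_eq_of_mem hB (Finset.mem_of_min hj)
  refine ⟨j, ?_, by rw [letter_eq_blockRank, hjB]⟩
  have h3 : B.min < (P.part i).min := by
    by_contra! hle
    rcases hle.lt_or_eq with h | h
    · exact absurd hlt (blockRank_lt hB h).not_gt
    · exact absurd (congrArg (blockRank P) (parts_min_injOn P hi hB h)) hlt.ne'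
  have h4 : (P.part i).min ≤ i := Finset.min_le (P.mem_part (Finset.mem_univ i))
  rw [hj] at h3
  exact WithTop.coe_lt_coe.1 (h3.trans_le h4)

/-- A restricted growth function is determined by its kernel. -/
theorem IsRGFun.eq_of_kernel {f g : Fin n → ℕ} (hf : IsRGFun f) (hg : IsRGFun g)
    (h : ∀ i j, f i = f j ↔ g i = g j) : f = g := by
  funext i
  induction i using WellFoundedLT.induction with
  | _ i ih =>
  rcases lt_trichotomy (f i) (g i) with hlt | heq | hgt
  · obtain ⟨j, hj, hgj⟩ := (hg i).2 _ (hf i).1 hlt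
    have : f j = f i := by rw [ih j hj, hgj]
    rw [← this, ih j hj, (h j i).1 this]
  · exact heq
  · obtain ⟨j, hj, hfj⟩ := (hf i).2 _ (hg i).1 hgt
    have : g j = g i := by rw [← ih j hj, hfj]
    rw [← this, ← ih j hj, (h j i).2 this]

theorem letter_injective :
    Function.Injective (letter : Finpartition (Finset.univ : Finset (Fin n)) → Fin n → ℕ) := by
  intro P Q h
  have key : ∀ i, P.part i = Q.part i := by
    intro i
    ext j
    rw [P.mem_part_iff_part_eq_part (Finset.mem_univ _) (Finset.mem_univ _),
      Q.mem_part_iff_part_eq_part (Finset.mem_univ _) (Finset.mem_univ _),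
      ← letter_eq_letter_iff, ← letter_eq_letter_iff, h]
  have sub : ∀ P Q : Finpartition (Finset.univ : Finset (Fin n)),
      (∀ i, P.part i = Q.part i) → P.parts ⊆ Q.parts := by
    intro P Q h B hB
    obtain ⟨i, hi⟩ := P.nonempty_of_mem_parts hB
    rw [← P.part_eq_of_mem hB hi, h]
    exact Q.part_mem.2 (Finset.mem_univ _)
  exact Finpartition.ext ((sub P Q key).antisymm (sub Q P fun i => (key i).symm))

/-- Take the partition into fibres of `f`: its letter function has the same kernel, and a restricted
growth function is determined by its kernel. -/
theorem exists_letter_eq {f : Fin n → ℕ} (hf : IsRGFun f) :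
    ∃ P : Finpartition (Finset.univ : Finset (Fin n)), letter P = f := by
  refine ⟨Finpartition.ofSetoid (Setoid.ker f), (isRGFun_letter _).eq_of_kernel hf fun i j => ?_⟩
  rw [letter_eq_letter_iff, ← Finpartition.mem_part_iff_part_eq_part _ (Finset.mem_univ _)
    (Finset.mem_univ _), Finpartition.mem_part_ofSetoid_iff_rel]
  exact eq_comm

theorem word_injective :
    Function.Injective (word : Finpartition (Finset.univ : Finset (Fin n)) → List ℕ) :=
  fun _ _ h => letter_injective (List.ofFn_injective h)

theorem length_word (P : Finpartition (Finset.univ : Finset (Fin n))) : (word P).length = n :=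
  List.length_ofFn

theorem isRGFun_iff (f : Fin n → ℕ) : IsRGFun f ↔ RGFrom 0 (List.ofFn f) := by
  rw [RGFrom_iff_forall_append]
  constructor
  · intro hf p c s h
    have hlen : p.length < n := by
      have := congrArg List.length h
      simp at this; omega
    have hc : f ⟨p.length, hlen⟩ = c := by
      have : (List.ofFn f)[p.length]'(by simpa using hlen) = c := by simp [h]
      simpa using this
    obtain ⟨h1, h2⟩ := hf ⟨p.length, hlen⟩
    rw [hc] at h1 h2
    refine ⟨h1, fun d hd => ?_⟩
    rcases Nat.eq_zero_or_pos d with rfl | hd0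
    · exact .inl le_rfl
    · obtain ⟨j, hj, rfl⟩ := h2 d hd0 hd
      right
      have hj' : (j : ℕ) < p.length := hj
      have : (List.ofFn f)[(j : ℕ)]'(by simp) = p[(j : ℕ)] := by
        simp only [h]
        exact List.getElem_append_left hj'
      simp at this
      rw [this]
      exact List.getElem_mem _
  · intro h i
    have hi : (i : ℕ) < (List.ofFn f).length := by simp
    obtain ⟨h1, h2⟩ := h ((List.ofFn f).take i) (f i) ((List.ofFn f).drop (i + 1)) (by
      conv_lhs => rw [← List.take_append_drop (i : ℕ) (List.ofFn f),
        List.drop_eq_getElem_cons hi]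
      simp)
    refine ⟨h1, fun d hd hlt => ?_⟩
    rcases h2 d hlt with h3 | h3
    · omega
    · obtain ⟨j, hj, he⟩ := List.mem_take_iff_getElem.1 h3
      refine ⟨⟨j, by simp at hj; omega⟩, ?_, by simpa using he⟩
      rw [Fin.lt_def]
      simp at hj ⊢; omega

theorem nonCrossing_iff (P : Finpartition (Finset.univ : Finset (Fin n))) :
    NonCrossing P ↔ NCWord (word P) := by
  unfold NonCrossing NCWord
  rw [not_iff_comm]
  push Not
  constructor
  · rintro ⟨c, d, hcd, h⟩
    rw [List.sublist_iff_exists_fin_orderEmbedding_get_eq] at h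
    obtain ⟨f, hf⟩ := h
    have hl : (word P).length = n := length_word P
    have e : ∀ i : Fin 4, letter P (Fin.cast hl (f i)) = [c, d, c, d].get i := by
      intro i
      rw [hf i]
      simp [word]
      rfl
    have lt : ∀ i j : Fin 4, i < j → Fin.cast hl (f i) < Fin.cast hl (f j) := by
      intro i j hij
      simpa using f.strictMono hij
    have e0 := e 0
    have e1 := e 1
    have e2 := e 2
    have e3 := e 3
    simp at e0 e1 e2 e3
    refine ⟨_, _, _, _, lt 0 1 (by decide), lt 1 2 (by decide), lt 2 3 (by decide), ?_, ?_, ?_⟩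
    · exact e0.trans e2.symm
    · exact e1.trans e3.symm
    · exact lt_of_eq_of_lt e0 (lt_of_lt_of_eq hcd e1.symm)
  · rintro ⟨i, j, k, l, hij, hjk, hkl, h1, h2, h3⟩
    refine ⟨letter P i, letter P j, h3, ?_⟩
    have : List.Sublist ([i, j, k, l].map (letter P)) ((List.finRange n).map (letter P)) := by
      refine List.Sublist.map _ ?_
      refine List.sublist_of_subperm_of_pairwise (r := (· < ·)) ?_ ?_ ?_
      · exact List.subperm_of_subset (by simp; omega) (fun x _ => List.mem_finRange x)
      · simp; omega
      · exact List.pairwise_lt_finRange n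
    rw [word, List.ofFn_eq_map]
    simpa [← h1, ← h2] using this

end Partition

/-! ### Non-crossing partitions as binary trees -/

theorem image_word_NC (n : ℕ) :
    (NC n).image word = (BinaryTree.treesOfNumNodesEq n).image toWord := by
  ext w
  simp only [NC, Finset.mem_image, Finset.mem_filter, Finset.mem_univ, true_and,
    BinaryTree.mem_treesOfNumNodesEq, nonCrossing_iff]
  constructor
  · rintro ⟨P, hP, rfl⟩
    obtain ⟨t, ht⟩ := exists_toWord_eq n (word P) (length_word P)
      ((isRGFun_iff _).1 (isRGFun_letter P)) hP
    exact ⟨t, by rw [← length_toWord, ht, length_word], ht⟩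
  · rintro ⟨t, rfl, rfl⟩
    have hl := length_toWord t
    set f : Fin t.numNodes → ℕ := fun i => (toWord t)[(i : ℕ)]'(by rw [hl]; exact i.2)
    have hf : List.ofFn f = toWord t := List.ext_getElem (by simp [hl]) (by simp [f])
    obtain ⟨P, hP⟩ := exists_letter_eq ((isRGFun_iff f).2 (hf ▸ toWord_rgFrom t))
    have hw : word P = toWord t := by rw [word, hP, hf]
    exact ⟨P, hw ▸ toWord_ncWord t, hw⟩

theorem sum_NC_word {M : Type*} [AddCommMonoid M] (n : ℕ) (F : List ℕ → M) :
    ∑ P ∈ NC n, F (word P) = ∑ t ∈ BinaryTree.treesOfNumNodesEq n, F (toWord t) := by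
  rw [← Finset.sum_image (g := word) (f := F) fun P _ Q _ h => word_injective h, image_word_NC,
    Finset.sum_image fun s _ t _ h => toWord_injective h]

section

open BinaryTree

/-! ### The statistics on binary trees -/

/-- The number of occurrences of the pattern in the word of a tree, preceded by `12⋯ℓ`. -/
def treeMu (a m l : ℕ) (t : BinaryTree Unit) : ℕ :=
  occ (pat a m) (List.range' 1 l ++ (toWord t).map (· + l))

/-- The length of the initial run of letters `1` in the word of a tree. -/
def initialRun : BinaryTree Unit → ℕ
  | nil => 0
  | node _ nil t => initialRun t + 1
  | node _ (node _ _ _) _ => 1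

/-- The smallest repeated letter of the word of a tree, or `0`. -/
def treeRep : BinaryTree Unit → ℕ
  | nil => 0
  | node _ s nil => if treeRep s = 0 then 0 else treeRep s + 1
  | node _ _ (node _ _ _) => 1

theorem treeMu_zero (a m : ℕ) (t : BinaryTree Unit) :
    treeMu a m 0 t = occ (pat a m) (toWord t) := by
  simp [treeMu]

theorem treeMu_nil {a m : ℕ} (ha : 2 ≤ a) (hm : 2 ≤ m) (l : ℕ) : treeMu a m l nil = 0 := by
  simp [treeMu, occ_pat_range' ha hm]

theorem replicate_prefix_iff (l k : ℕ) (t : BinaryTree Unit) :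
    List.replicate k (1 + l) <+: (toWord t).map (· + l) ↔ k ≤ initialRun t := by
  induction t generalizing k with
  | nil => cases k <;> simp [initialRun, List.replicate_succ]
  | node i s t hs ht =>
    cases k with
    | zero => simp
    | succ k =>
      cases s with
      | nil =>
        have : (lift 0) = id := by funext c; simp [lift]
        simp [toWord_node, initialRun, List.replicate_succ, List.cons_prefix_cons, ← ht, this]
      | node j s₁ s₂ =>
        cases k <;> simp [toWord_node, initialRun, List.replicate_succ, List.cons_prefix_cons]

/-- For nonempty `t` the word begins with a doubled 1. Dropping one copy loses no occurrence inside
the word, and the prefix adds at most one. -/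
theorem treeMu_node_nil {a m : ℕ} (ha : 2 ≤ a) (hm : 2 ≤ m) (l : ℕ) (i : Unit)
    (t : BinaryTree Unit) :
    treeMu a m l (node i nil t) =
      treeMu a m 0 t + if m - 1 ≤ l ∧ a ≤ initialRun t + 1 then 1 else 0 := by
  have hlift : (lift 0) = id := by funext c; simp [lift]
  by_cases ht : t = nil
  · subst ht
    have := occ_pat_range' ha hm 1 (l + 1)
    rw [List.range'_concat] at this
    rw [treeMu_nil ha hm, if_neg (by simp [initialRun]; omega), treeMu]
    simpa [toWord_node] using this
  · obtain ⟨w, hw⟩ := toWord_eq_cons ht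
    have h1 := occ_pat_range'_append ha hm 1 l (w.map (· + l))
    have h2 : (1 + l) :: w.map (· + l) = (toWord t).map (· + l) := by simp [hw]
    rw [occ_pat_cons_self ha hm, h2] at h1
    have h3 : List.replicate a (1 + l) <+: (1 + l) :: (toWord t).map (· + l) ↔
        a ≤ initialRun t + 1 := by
      obtain ⟨b, rfl⟩ : ∃ b, a = b + 1 := ⟨a - 1, by omega⟩
      rw [List.replicate_succ, List.cons_prefix_cons, replicate_prefix_iff]
      simp
    rw [if_congr (and_congr_right fun _ => h3) rfl rfl,
      occ_map (fun a b h => Nat.add_lt_add_right h l)] at h1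
    rw [treeMu_zero, ← h1, treeMu]
    simp [toWord_node, hlift]

/-- The left part ends in a letter at least 2; if the right part is nonempty, its initial 1 creates
a descent that no occurrence crosses. The root letter extends the prefix of the left part. -/
theorem treeMu_node_of_ne_nil {a m : ℕ} (hm : 2 ≤ m) (l : ℕ) (i : Unit)
    {s : BinaryTree Unit} (hs : s ≠ nil) (t : BinaryTree Unit) :
    treeMu a m l (node i s t) = treeMu a m (l + 1) s + treeMu a m 0 t := by
  have hpre : List.range' 1 l ++ [1 + l] = List.range' 1 (l + 1) := by
    rw [List.range'_concat, one_mul]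
  by_cases ht : t = nil
  · subst ht
    rw [treeMu_zero, toWord_nil, occ_nil (pat_ne_nil hm), add_zero, treeMu, treeMu, ← hpre]
    simp [toWord_node, Function.comp_def, add_assoc, add_comm 1 l]
  · obtain ⟨w, hw⟩ := toWord_eq_cons ht
    obtain ⟨s₀, b, hsb⟩ := (toWord s).eq_nil_or_concat'.resolve_left
      (fun h => hs (toWord_eq_nil_iff.1 h))
    set K := maxLetter 0 (toWord s)
    have hb : 1 ≤ b := one_le_of_mem_toWord (t := s) (by simp [hsb])
    have hmono : StrictMono fun c => lift K c + l :=
      fun c d h => Nat.add_lt_add_right (lift_strictMono K h) l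
    have h1 := occ_append_of_descent (pat_ne_nil (a := a) hm) (pat_mono hm)
      (List.range' 1 (l + 1) ++ s₀.map (· + (l + 1))) (b + (l + 1)) (1 + l) (by omega)
      (w.map fun c => lift K c + l)
    have h2 : (1 + l) :: w.map (fun c => lift K c + l) =
        (toWord t).map (fun c => lift K c + l) := by simp [hw]
    rw [h2, occ_map hmono] at h1
    rw [treeMu_zero, treeMu, treeMu]
    convert h1 using 2
    · rw [toWord_node, ← hpre, show maxLetter 0 (toWord s) = K from rfl, hsb]
      simp [Function.comp_def, add_assoc, add_comm 1 l]
    · rw [hsb]; simp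

theorem treeMu_node {a m : ℕ} (ha : 2 ≤ a) (hm : 2 ≤ m) (l : ℕ) (i : Unit)
    (s t : BinaryTree Unit) :
    treeMu a m l (node i s t) = treeMu a m (l + 1) s + treeMu a m 0 t +
      if s = nil ∧ m - 1 ≤ l ∧ a ≤ initialRun t + 1 then 1 else 0 := by
  by_cases hs : s = nil
  · subst hs
    rw [treeMu_node_nil ha hm, treeMu_nil ha hm]
    simp
  · rw [treeMu_node_of_ne_nil hm l i hs]
    simp [hs]

/-- A nonempty right subtree supplies a second 1; if it is empty, 1 occurs once and all repetitions
are shifted ones of the left word. -/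
theorem sInf_count_eq_treeRep (t : BinaryTree Unit) :
    sInf {c : ℕ | 2 ≤ (toWord t).count c} = treeRep t := by
  have hpos : ∀ (t : BinaryTree Unit) c, 2 ≤ (toWord t).count c → 1 ≤ c := fun t c h =>
    one_le_of_mem_toWord (List.count_pos_iff.1 (by omega : 0 < (toWord t).count c))
  induction t with
  | nil => simp [treeRep]
  | node i s t hs ht =>
    cases t with
    | nil =>
      have hset : ∀ c, 2 ≤ (toWord (node i s nil)).count c ↔
          ∃ d, 2 ≤ (toWord s).count d ∧ c = d + 1 := by
        intro c
        rw [toWord_node, toWord_nil, List.map_nil, List.append_nil]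
        have hinj : Function.Injective (fun c : ℕ => c + 1) := fun a b h => by simpa using h
        cases c with
        | zero => simp [List.count_eq_zero_of_not_mem]
        | succ c =>
          rw [List.count_cons, List.count_map_of_injective _ (fun c : ℕ => c + 1) hinj]
          rcases Nat.eq_zero_or_pos c with rfl | hc
          · have : (toWord s).count 0 = 0 := List.count_eq_zero_of_not_mem fun h => by
              have := one_le_of_mem_toWord h
              omega
            simp [this]
          · simp [hc.ne']
      by_cases he : ∃ d, 2 ≤ (toWord s).count d
      · have h1 : 2 ≤ (toWord s).count (treeRep s) := by rw [← hs]; exact Nat.sInf_mem he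
        have h2 := hpos s _ h1
        simp only [treeRep]
        rw [if_neg (by omega)]
        apply le_antisymm
        · exact Nat.sInf_le ((hset _).2 ⟨_, h1, rfl⟩)
        · refine le_csInf ⟨_, (hset _).2 ⟨_, h1, rfl⟩⟩ fun c hc => ?_
          obtain ⟨d, hd, rfl⟩ := (hset c).1 hc
          rw [← hs]
          exact Nat.add_le_add_right (Nat.sInf_le (s := {c | 2 ≤ (toWord s).count c}) hd) 1
      · have h1 : {c : ℕ | 2 ≤ (toWord s).count c} = ∅ := by
          ext c; simp only [Set.mem_ofPred_eq, Set.mem_empty_iff_false, iff_false]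
          exact fun h => he ⟨c, h⟩
        have h2 : {c : ℕ | 2 ≤ (toWord (node i s nil)).count c} = ∅ := by
          ext c; simp only [Set.mem_ofPred_eq, Set.mem_empty_iff_false, iff_false]
          rw [hset]
          exact fun ⟨d, h, _⟩ => he ⟨d, h⟩
        rw [h1, Nat.sInf_empty] at hs
        simp [h2, treeRep, ← hs]
    | node j t₁ t₂ =>
      have h1 : 2 ≤ (toWord (node i s (node j t₁ t₂))).count 1 := by
        rw [toWord_node, toWord_node j]
        simp [List.count_append]
        omega
      simp only [treeRep]
      exact le_antisymm (Nat.sInf_le h1) (le_csInf ⟨_, h1⟩ fun c hc => hpos _ c hc)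

theorem treeRep_node_of_ne_nil (i : Unit) (s : BinaryTree Unit) {t : BinaryTree Unit}
    (ht : t ≠ nil) : treeRep (node i s t) = 1 := by
  cases t with
  | nil => exact absurd rfl ht
  | node => rfl

theorem cnt_eq (a m l n : ℕ) :
    cnt a m l n = ∑ t ∈ treesOfNumNodesEq n, Polynomial.X ^ treeMu a m l t :=
  sum_NC_word n fun w =>
    (Polynomial.X : Polynomial ℤ) ^ occ (pat a m) (List.range' 1 l ++ w.map (· + l))

theorem cntRep_eq (a m l n i : ℕ) :
    cntRep a m l n i = ∑ t ∈ treesOfNumNodesEq n,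
      if treeRep t = i then Polynomial.X ^ treeMu a m l t else 0 := by
  rw [cntRep, Finset.sum_filter]
  refine (sum_NC_word n fun w => if sInf {c : ℕ | 2 ≤ w.count c} = i then
    (Polynomial.X : Polynomial ℤ) ^ occ (pat a m) (List.range' 1 l ++ w.map (· + l)) else 0).trans
      ?_
  simp only [sInf_count_eq_treeRep]
  rfl

theorem occ_word (a m : ℕ) {n : ℕ} (P : Finpartition (Finset.univ : Finset (Fin n))) :
    occ (pat a m) (word P) = mu a m 0 P := by
  simp [mu]

end

section

open BinaryTree PowerSeries

/-! ### Recurrences for the generating functions in the variable `x` -/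

section Trees

variable {M : Type*} [AddCommMonoid M]

theorem sum_trees_succ (n : ℕ) (F : BinaryTree Unit → M) :
    ∑ t ∈ treesOfNumNodesEq (n + 1), F t = ∑ ij ∈ Finset.HasAntidiagonal.antidiagonal n,
      ∑ s ∈ treesOfNumNodesEq ij.1, ∑ t ∈ treesOfNumNodesEq ij.2, F (node () s t) := by
  rw [treesOfNumNodesEq_succ, Finset.sum_biUnion]
  · refine Finset.sum_congr rfl fun ij _ => ?_
    rw [Finset.sum_map, Finset.sum_product]
    rfl
  · rintro ⟨i, j⟩ _ ⟨i', j'⟩ _ hne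
    rw [Function.onFun, Finset.disjoint_left]
    intro t h h'
    simp only [Finset.mem_map, Finset.mem_product, mem_treesOfNumNodesEq] at h h'
    obtain ⟨⟨s, t⟩, ⟨h1, h2⟩, rfl⟩ := h
    obtain ⟨⟨s', t'⟩, ⟨h1', h2'⟩, h⟩ := h'
    simp at h
    simp at h1 h2 h1' h2'
    exact hne (by rw [← h1, ← h2, ← h1', ← h2', h.1, h.2])

theorem sum_trees_succ_left_nil (n : ℕ) (F : BinaryTree Unit → M)
    (hF : ∀ s t, s ≠ nil → F (node () s t) = 0) :
    ∑ t ∈ treesOfNumNodesEq (n + 1), F t = ∑ t ∈ treesOfNumNodesEq n, F (node () nil t) := by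
  rw [sum_trees_succ, Finset.sum_eq_single (0, n)]
  · simp
  · rintro ⟨i, j⟩ hij hne
    refine Finset.sum_eq_zero fun s hs => Finset.sum_eq_zero fun t _ => hF s t ?_
    rintro rfl
    rw [mem_treesOfNumNodesEq] at hs
    rw [Finset.HasAntidiagonal.mem_antidiagonal] at hij
    simp only [numNodes] at hs
    exact hne (Prod.ext hs.symm (by simp at hij ⊢; omega))
  · simp

theorem sum_trees_succ_right_nil (n : ℕ) (F : BinaryTree Unit → M)
    (hF : ∀ s t, t ≠ nil → F (node () s t) = 0) :
    ∑ t ∈ treesOfNumNodesEq (n + 1), F t = ∑ s ∈ treesOfNumNodesEq n, F (node () s nil) := by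
  rw [sum_trees_succ, Finset.sum_eq_single (n, 0)]
  · simp
  · rintro ⟨i, j⟩ hij hne
    refine Finset.sum_eq_zero fun s _ => Finset.sum_eq_zero fun t ht => hF s t ?_
    rintro rfl
    rw [mem_treesOfNumNodesEq] at ht
    rw [Finset.HasAntidiagonal.mem_antidiagonal] at hij
    simp only [numNodes] at ht
    exact hne (Prod.ext (by simp at hij ⊢; omega) ht.symm)
  · simp

end Trees

theorem treeMu_node_right_nil {a m : ℕ} (ha : 2 ≤ a) (hm : 2 ≤ m) (l : ℕ) (i : Unit)
    (s : BinaryTree Unit) : treeMu a m l (node i s nil) = treeMu a m (l + 1) s := by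
  rw [treeMu_node ha hm, treeMu_nil ha hm, if_neg, add_zero, add_zero]
  simp only [initialRun]; omega

theorem treeRep_node_right_nil (i : Unit) (s : BinaryTree Unit) :
    treeRep (node i s nil) = if treeRep s = 0 then 0 else treeRep s + 1 := by
  rw [treeRep]

/-- The series `∑_n a^{(ℓ)}(n) x^n`. -/
def prefSer (a m l : ℕ) : PowerSeries (Polynomial ℤ) := .mk fun n => cnt a m l n

/-- The series `∑_n a^{(ℓ)}(n,i) x^n`. -/
def repSer (a m l i : ℕ) : PowerSeries (Polynomial ℤ) := .mk fun n => cntRep a m l n i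

/-- The series of the non-crossing partitions starting with `r` copies of the letter `1`. -/
def runSer (a m r : ℕ) : PowerSeries (Polynomial ℤ) := .mk fun n =>
  ∑ t ∈ treesOfNumNodesEq n, if r ≤ initialRun t then Polynomial.X ^ treeMu a m 0 t else 0

variable {a m : ℕ}

theorem constantCoeff_prefSer (ha : 2 ≤ a) (hm : 2 ≤ m) (l : ℕ) :
    constantCoeff (prefSer a m l) = 1 := by
  rw [← coeff_zero_eq_constantCoeff_apply]
  simp [prefSer, cnt_eq, treeMu_nil ha hm]

theorem runSer_one (ha : 2 ≤ a) (hm : 2 ≤ m) : runSer a m 1 = prefSer a m 0 - 1 := by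
  ext n : 1
  cases n with
  | zero => simp [runSer, initialRun, constantCoeff_prefSer ha hm]
  | succ n =>
    rw [map_sub, coeff_one, if_neg n.succ_ne_zero, sub_zero, runSer, prefSer, coeff_mk, coeff_mk,
      cnt_eq]
    refine Finset.sum_congr rfl fun t ht => if_pos ?_
    match t with
    | nil => simp at ht
    | node _ nil t => simp [initialRun]
    | node _ (node _ _ _) t => simp [initialRun]

/-- A run of at least two forces an empty left subtree; deleting the root shortens the run by one
and, without a prefix, keeps the number of occurrences. -/
theorem runSer_add_two (ha : 2 ≤ a) (hm : 2 ≤ m) (r : ℕ) :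
    runSer a m (r + 2) = X * runSer a m (r + 1) := by
  ext n : 1
  cases n with
  | zero => simp [runSer, initialRun]
  | succ n =>
    rw [coeff_succ_X_mul, runSer, runSer, coeff_mk, coeff_mk, sum_trees_succ_left_nil]
    · refine Finset.sum_congr rfl fun t _ => ?_
      rw [treeMu_node_nil ha hm, if_neg (show ¬ (m - 1 ≤ 0 ∧ _) by omega), add_zero]
      simp [initialRun]
    · intro s t hs
      cases s with
      | nil => exact absurd rfl hs
      | node => simp [initialRun]

theorem runSer_succ (ha : 2 ≤ a) (hm : 2 ≤ m) (r : ℕ) :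
    runSer a m (r + 1) = X ^ r * (prefSer a m 0 - 1) := by
  induction r with
  | zero => rw [zero_add, runSer_one ha hm, pow_zero, one_mul]
  | succ r ih => rw [runSer_add_two ha hm, ih, pow_succ', mul_assoc]

/-- Decomposition of a non-crossing partition at the second occurrence of its first letter. -/
theorem prefSer_eq (ha : 2 ≤ a) (hm : 2 ≤ m) (l : ℕ) :
    prefSer a m l = 1 + X * (prefSer a m 0 * prefSer a m (l + 1)) +
      if m - 1 ≤ l then C (Polynomial.X - 1) * (X ^ (a - 1) * (prefSer a m 0 - 1)) else 0 := by
  have hrun : X ^ (a - 1) * (prefSer a m 0 - 1) = X * runSer a m (a - 1) := by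
    obtain ⟨b, rfl⟩ : ∃ b, a = b + 2 := ⟨a - 2, by omega⟩
    rw [show b + 2 - 1 = b + 1 by omega, runSer_succ ha hm, pow_succ']
    ring
  rw [hrun]
  ext n : 1
  cases n with
  | zero => split_ifs <;> simp [constantCoeff_prefSer ha hm]
  | succ n =>
    -- Writing q^[p] = 1 + [p](q - 1) separates the plain product from the correction for
    -- occurrences starting in the prefix.
    have hpow : ∀ (p : Prop) [Decidable p], (Polynomial.X : Polynomial ℤ) ^ (if p then 1 else 0) =
        1 + if p then Polynomial.X - 1 else 0 := by
      intro p _; split_ifs <;> ring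
    have hlast : coeff (n + 1) (if m - 1 ≤ l then C (Polynomial.X - 1) * (X * runSer a m (a - 1))
        else 0) = if m - 1 ≤ l then (Polynomial.X - 1) * coeff n (runSer a m (a - 1)) else 0 := by
      split_ifs
      · rw [coeff_C_mul, coeff_succ_X_mul]
      · simp
    rw [map_add, map_add, coeff_one, if_neg n.succ_ne_zero, zero_add, coeff_succ_X_mul, hlast,
      coeff_mul, ← Finset.Nat.sum_antidiagonal_swap]
    simp only [prefSer, runSer, coeff_mk, cnt_eq, Prod.fst_swap, Prod.snd_swap]
    rw [sum_trees_succ]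
    simp only [treeMu_node ha hm, pow_add, hpow, mul_add, mul_one, Finset.sum_add_distrib]
    congr 1
    · refine Finset.sum_congr rfl fun ij _ => ?_
      rw [mul_comm, Finset.sum_mul_sum]
    -- The correction is supported on empty left subtrees, so the double sum collapses to one over
    -- right subtrees; the value at `nil` is irrelevant.
    · have := sum_trees_succ_left_nil (M := Polynomial ℤ) n (fun r => match r with
        | nil => 0
        | node _ s t => (Polynomial.X : Polynomial ℤ) ^ treeMu a m (l + 1) s *
            Polynomial.X ^ treeMu a m 0 t * if s = nil ∧ m - 1 ≤ l ∧ a ≤ initialRun t + 1 then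
              Polynomial.X - 1 else 0) (fun s t hs => by simp [hs])
      rw [sum_trees_succ] at this
      refine this.trans ?_
      split_ifs with hl
      · rw [Finset.mul_sum]
        refine Finset.sum_congr rfl fun t _ => ?_
        simp only [treeMu_nil ha hm, hl, true_and, pow_zero, one_mul]
        have : a ≤ initialRun t + 1 ↔ a - 1 ≤ initialRun t := by omega
        rw [if_congr this rfl rfl]
        split_ifs <;> ring
      · simp [hl]

/-- Since y - 1 is divisible by x, the correction in the recurrence is divisible by x^a; below that
degree what remains is the Catalan recurrence, for every `l`. -/
theorem coeff_prefSer_of_lt (ha : 2 ≤ a) (hm : 2 ≤ m) (n : ℕ) (hn : n < a) (l : ℕ) :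
    coeff n (prefSer a m l) = (catalan n : Polynomial ℤ) := by
  induction n using Nat.strong_induction_on generalizing l with
  | _ n ih =>
  cases n with
  | zero => simp [constantCoeff_prefSer ha hm]
  | succ n =>
    have h0 : X ^ (a - 1) * (prefSer a m 0 - 1) =
        X ^ a * (prefSer a m 0 * prefSer a m 1) := by
      have h1 := prefSer_eq ha hm 0
      rw [if_neg (by omega)] at h1
      obtain ⟨b, rfl⟩ : ∃ b, a = b + 1 := ⟨a - 1, by omega⟩
      rw [Nat.add_sub_cancel, pow_succ]
      linear_combination X ^ b * h1
    have hz : coeff (n + 1) (if m - 1 ≤ l then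
        C (Polynomial.X - 1 : Polynomial ℤ) * (X ^ (a - 1) * (prefSer a m 0 - 1)) else 0) = 0 := by
      split_ifs
      · rw [h0, coeff_C_mul, coeff_X_pow_mul', if_neg (by omega), mul_zero]
      · simp
    rw [prefSer_eq ha hm l, map_add, map_add, hz, coeff_one, if_neg n.succ_ne_zero, zero_add,
      add_zero, coeff_succ_X_mul, coeff_mul, catalan_succ', Nat.cast_sum]
    refine Finset.sum_congr rfl fun ij hij => ?_
    rw [Finset.HasAntidiagonal.mem_antidiagonal] at hij
    rw [ih _ (by omega) (by omega), ih _ (by omega) (by omega), Nat.cast_mul]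

/-- By complement: the value 1 fails exactly for the empty tree and for trees with empty right
subtree, which contribute 1 and x F_{l+1}. -/
theorem repSer_one (ha : 2 ≤ a) (hm : 2 ≤ m) (l : ℕ) :
    repSer a m l 1 = prefSer a m l - 1 - X * prefSer a m (l + 1) := by
  rw [eq_sub_iff_add_eq, eq_sub_iff_add_eq]
  ext n : 1
  cases n with
  | zero => simp [repSer, cntRep_eq, treeRep, constantCoeff_prefSer ha hm]
  | succ n =>
    rw [map_add, map_add, coeff_one, if_neg n.succ_ne_zero, add_zero, coeff_succ_X_mul]
    simp only [repSer, prefSer, coeff_mk, cntRep_eq, cnt_eq]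
    have h := sum_trees_succ_right_nil n (fun t =>
      if treeRep t = 1 then 0 else (Polynomial.X : Polynomial ℤ) ^ treeMu a m l t)
      (fun s t ht => by simp [treeRep_node_of_ne_nil _ _ ht])
    have h2 : ∑ s ∈ treesOfNumNodesEq n, (Polynomial.X : Polynomial ℤ) ^ treeMu a m (l + 1) s =
        ∑ s ∈ treesOfNumNodesEq n, if treeRep (node () s nil) = 1 then 0 else
          Polynomial.X ^ treeMu a m l (node () s nil) := by
      refine Finset.sum_congr rfl fun s _ => ?_
      rw [if_neg, treeMu_node_right_nil ha hm]
      rw [treeRep_node_right_nil]; by_cases h : treeRep s = 0 <;> simp [h]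
    rw [h2, ← h, ← Finset.sum_add_distrib]
    refine Finset.sum_congr rfl fun t _ => ?_
    split_ifs <;> simp

/-- A value above 1 forces an empty right subtree; removing the root lowers the value by one and
lengthens the prefix by one. -/
theorem repSer_add_two (ha : 2 ≤ a) (hm : 2 ≤ m) (l i : ℕ) :
    repSer a m l (i + 2) = X * repSer a m (l + 1) (i + 1) := by
  ext n : 1
  cases n with
  | zero => simp [repSer, cntRep_eq, treeRep]
  | succ n =>
    rw [coeff_succ_X_mul]
    simp only [repSer, coeff_mk, cntRep_eq]
    rw [sum_trees_succ_right_nil]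
    · refine Finset.sum_congr rfl fun s _ => ?_
      have : treeRep (node () s nil) = i + 2 ↔ treeRep s = i + 1 := by
        rw [treeRep_node_right_nil]; by_cases h : treeRep s = 0 <;> simp [h]
      rw [if_congr this rfl rfl, treeMu_node_right_nil ha hm]
    · intro s t ht
      rw [treeRep_node_of_ne_nil _ _ ht, if_neg (by omega)]

/-- Each size has a single partition without repeated letter, and its increasing word contains no τ:
the series is 1/(1-x). -/
theorem repSer_zero (ha : 2 ≤ a) (hm : 2 ≤ m) (l : ℕ) :
    repSer a m l 0 = PowerSeries.mk 1 := by
  ext n : 1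
  induction n generalizing l with
  | zero => simp [repSer, cntRep_eq, treeRep, treeMu_nil ha hm]
  | succ n ih =>
    have h := ih (l + 1)
    simp only [repSer, coeff_mk, cntRep_eq] at h ⊢
    rw [sum_trees_succ_right_nil]
    · rw [Pi.one_apply] at h ⊢
      rw [← h]
      refine Finset.sum_congr rfl fun s _ => ?_
      have : treeRep (node () s nil) = 0 ↔ treeRep s = 0 := by
        rw [treeRep_node_right_nil]; by_cases h : treeRep s = 0 <;> simp [h]
      rw [if_congr this rfl rfl, treeMu_node_right_nil ha hm]
    · intro s t ht
      rw [treeRep_node_of_ne_nil _ _ ht, if_neg (by omega)]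

theorem repSer_succ (ha : 2 ≤ a) (hm : 2 ≤ m) (l i : ℕ) :
    repSer a m l (i + 1) = X ^ i * repSer a m (l + i) 1 := by
  induction i generalizing l with
  | zero => simp
  | succ i ih =>
    rw [repSer_add_two ha hm, ih, pow_succ', mul_assoc, add_right_comm, add_assoc]

theorem coeff_repSer_one_zero (ha : 2 ≤ a) (hm : 2 ≤ m) (l : ℕ) :
    coeff 0 (repSer a m l 1) = 0 := by
  rw [repSer_one ha hm]
  simp [constantCoeff_prefSer ha hm]

theorem coeff_repSer_one_succ_of_lt (ha : 2 ≤ a) (hm : 2 ≤ m) (n : ℕ) (hn : n + 1 < a) (l : ℕ) :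
    coeff (n + 1) (repSer a m l 1) = (catalan (n + 1) : Polynomial ℤ) - catalan n := by
  rw [repSer_one ha hm, map_sub, map_sub, coeff_succ_X_mul, coeff_prefSer_of_lt ha hm _ hn,
    coeff_prefSer_of_lt ha hm _ (by omega), coeff_one, if_neg n.succ_ne_zero, sub_zero]

end

/-! ### Series in `x` and one further variable -/

/-- A power series in one variable, as a series in the first of three variables. -/
def embFirst (R : Type*) [CommRing R] : PowerSeries R →+* MvPowerSeries (Fin 3) R :=
  (MvPowerSeries.finSuccEquiv R 2).symm.toRingEquiv.toRingHom.comp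
    (PowerSeries.map MvPowerSeries.C)

section EmbFirst

variable {R : Type*} [CommRing R]

theorem embFirst_apply (g : PowerSeries R) :
    embFirst R g = (MvPowerSeries.finSuccEquiv R 2).symm (PowerSeries.map MvPowerSeries.C g) :=
  rfl

theorem finSuccEquiv_embFirst (g : PowerSeries R) :
    MvPowerSeries.finSuccEquiv R 2 (embFirst R g) = PowerSeries.map MvPowerSeries.C g := by
  rw [embFirst_apply, AlgEquiv.apply_symm_apply]

theorem coeff_cons_embFirst_mul (n : ℕ) (d : Fin 2 →₀ ℕ) (g : PowerSeries R)
    (f : MvPowerSeries (Fin 3) R) : MvPowerSeries.coeff (Finsupp.cons n d) (embFirst R g * f) =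
      ∑ ij ∈ Finset.HasAntidiagonal.antidiagonal n,
        PowerSeries.coeff ij.1 g * MvPowerSeries.coeff (Finsupp.cons ij.2 d) f := by
  rw [← MvPowerSeries.coeff_coeff_finSuccEquiv, map_mul, finSuccEquiv_embFirst,
    PowerSeries.coeff_mul, map_sum]
  refine Finset.sum_congr rfl fun ij _ => ?_
  rw [PowerSeries.coeff_map, MvPowerSeries.coeff_C_mul, MvPowerSeries.coeff_coeff_finSuccEquiv]

theorem coeff_cons_embFirst (n : ℕ) (d : Fin 2 →₀ ℕ) (g : PowerSeries R) :
    MvPowerSeries.coeff (Finsupp.cons n d) (embFirst R g) =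
      if d = 0 then PowerSeries.coeff n g else 0 := by
  rw [← MvPowerSeries.coeff_coeff_finSuccEquiv, finSuccEquiv_embFirst,
    PowerSeries.coeff_map, MvPowerSeries.coeff_C]

theorem embFirst_X : embFirst R PowerSeries.X = MvPowerSeries.X 0 := by
  rw [embFirst_apply, AlgEquiv.symm_apply_eq, PowerSeries.map_X, MvPowerSeries.finSuccEquiv_X_zero]

theorem embFirst_C (p : R) : embFirst R (PowerSeries.C p) = MvPowerSeries.C p := by
  rw [embFirst_apply, AlgEquiv.symm_apply_eq, PowerSeries.map_C, MvPowerSeries.finSuccEquiv_C]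

end EmbFirst

/-- A series in `x` alone, as a series in `x`, `u`, `v`. -/
def embX : PowerSeries (Polynomial ℤ) →+* GF := embFirst (Polynomial ℤ)

/-- The coefficient of a monomial in `u` and `v`, as a series in `x`. -/
def slice (d : Fin 2 →₀ ℕ) (f : GF) : PowerSeries (Polynomial ℤ) :=
  .mk fun n => MvPowerSeries.coeff (Finsupp.cons n d) f

theorem GF.ext_slice {f g : GF} (h : ∀ d, slice d f = slice d g) : f = g := by
  ext e : 1
  have := congrArg (PowerSeries.coeff (e 0)) (h (Finsupp.tail e))
  simpa [slice, Finsupp.cons_tail] using this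

theorem slice_add (d : Fin 2 →₀ ℕ) (f g : GF) : slice d (f + g) = slice d f + slice d g := by
  ext n : 1; simp [slice]

theorem slice_embX_mul (d : Fin 2 →₀ ℕ) (g : PowerSeries (Polynomial ℤ)) (f : GF) :
    slice d (embX g * f) = g * slice d f := by
  ext n : 1
  rw [slice, PowerSeries.coeff_mk, embX, coeff_cons_embFirst_mul, PowerSeries.coeff_mul]
  simp only [slice, PowerSeries.coeff_mk]

theorem slice_embX (d : Fin 2 →₀ ℕ) (g : PowerSeries (Polynomial ℤ)) :
    slice d (embX g) = if d = 0 then g else 0 := by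
  ext n : 1
  rw [slice, PowerSeries.coeff_mk, embX, coeff_cons_embFirst]
  split_ifs <;> simp

theorem slice_X_mul (d : Fin 2 →₀ ℕ) (j : Fin 2) (f : GF) :
    slice d (MvPowerSeries.X j.succ * f) =
      if d j = 0 then 0 else slice (d - Finsupp.single j 1) f := by
  ext n : 1
  rw [slice, PowerSeries.coeff_mk, MvPowerSeries.X, MvPowerSeries.coeff_monomial_mul, one_mul]
  have h1 : Finsupp.single j.succ 1 ≤ Finsupp.cons n d ↔ d j ≠ 0 := by
    rw [Finsupp.single_le_iff, Finsupp.cons_succ]; omega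
  rw [if_congr h1 rfl rfl, ite_not]
  split_ifs
  · simp
  · rw [slice, PowerSeries.coeff_mk]
    congr 2
    ext i
    refine Fin.cases ?_ (fun i => ?_) i
    · simp
    · simp [Finsupp.single_apply]

/-- The series `∑_k F_k z^k`, where the `F_k` are series in `x` and `z` is the variable `u`
(for `j = 0`) or `v` (for `j = 1`). -/
def ser (j : Fin 2) (F : ℕ → PowerSeries (Polynomial ℤ)) : GF := fun e =>
  if Finsupp.tail e = Finsupp.single j (e j.succ) then PowerSeries.coeff (e 0) (F (e j.succ)) else 0

theorem slice_ser (d : Fin 2 →₀ ℕ) (j : Fin 2) (F : ℕ → PowerSeries (Polynomial ℤ)) :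
    slice d (ser j F) = if d = Finsupp.single j (d j) then F (d j) else 0 := by
  ext n : 1
  rw [slice, PowerSeries.coeff_mk, MvPowerSeries.coeff_apply, ser, Finsupp.tail_cons,
    Finsupp.cons_succ, Finsupp.cons_zero]
  split_ifs <;> simp

theorem ser_add (j : Fin 2) (F G : ℕ → PowerSeries (Polynomial ℤ)) :
    ser j (fun k => F k + G k) = ser j F + ser j G := by
  refine GF.ext_slice fun d => ?_
  simp only [slice_add, slice_ser]
  split_ifs <;> simp

theorem ser_mul_left (j : Fin 2) (g : PowerSeries (Polynomial ℤ))
    (F : ℕ → PowerSeries (Polynomial ℤ)) :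
    ser j (fun k => g * F k) = embX g * ser j F := by
  refine GF.ext_slice fun d => ?_
  simp only [slice_embX_mul, slice_ser, mul_ite, mul_zero]

/-- Peeling off the term `k = 0` turns an index shift in a recurrence into an algebraic relation. -/
theorem ser_eq (j : Fin 2) (F : ℕ → PowerSeries (Polynomial ℤ)) :
    ser j F = embX (F 0) + MvPowerSeries.X j.succ * ser j (fun k => F (k + 1)) := by
  refine GF.ext_slice fun d => ?_
  rw [slice_add, slice_X_mul, slice_ser, slice_ser, slice_embX]
  rcases Nat.eq_zero_or_pos (d j) with h | h
  · simp [h]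
  · have h1 : d ≠ 0 := by rintro rfl; simp at h
    have h2 : (d - Finsupp.single j 1 : Fin 2 →₀ ℕ) j = d j - 1 := by simp
    have h3 : d - Finsupp.single j 1 = Finsupp.single j (d j - 1) ↔ d = Finsupp.single j (d j) := by
      constructor
      · intro h'
        ext i
        have := DFunLike.congr_fun h' i
        by_cases hi : j = i
        · subst hi; simp
        · simpa [Finsupp.single_apply, hi] using this
      · intro h'
        conv_lhs => rw [h']
        rw [← Finsupp.single_tsub]
    rw [if_neg h1, if_neg h.ne', h2, if_congr h3 rfl rfl, zero_add, Nat.sub_add_cancel h]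

theorem ser_ite (j : Fin 2) (r : ℕ) (F : ℕ → PowerSeries (Polynomial ℤ)) :
    ser j (fun k => if r ≤ k then F k else 0) =
      MvPowerSeries.X j.succ ^ r * ser j (fun k => F (k + r)) := by
  induction r generalizing F with
  | zero => simp
  | succ r ih =>
    rw [ser_eq, if_neg (by omega), map_zero, zero_add]
    simp only [Nat.add_le_add_iff_right]
    rw [ih fun k => F (k + 1), pow_succ', mul_assoc]
    simp only [add_assoc]

/-! ### Substitutions for `u` -/

theorem hasSubst_substU {s : GF} (hs : MvPowerSeries.constantCoeff s = 0) :
    MvPowerSeries.HasSubst (![gx, s, gv] : Fin 3 → GF) := by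
  refine MvPowerSeries.hasSubst_of_constantCoeff_zero fun i => ?_
  fin_cases i <;> simp [gx, gv, hs]

/-- Substitution for `u`, as a ring homomorphism. -/
def substUHom {s : GF} (hs : MvPowerSeries.constantCoeff s = 0) : GF →+* GF :=
  (MvPowerSeries.substAlgHom (R := Polynomial ℤ) (hasSubst_substU hs)).toRingHom

theorem substUHom_apply {s : GF} (hs : MvPowerSeries.constantCoeff s = 0) (f : GF) :
    substUHom hs f = substU s f :=
  MvPowerSeries.substAlgHom_apply (hasSubst_substU hs) f

theorem substUHom_gu {s : GF} (hs : MvPowerSeries.constantCoeff s = 0) :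
    substUHom hs gu = s := by
  rw [substUHom_apply, substU, gu, MvPowerSeries.subst_X (hasSubst_substU hs)]
  rfl

/-- Series without the variable `u` are not affected. -/
theorem substUHom_of_coeff_eq_zero {s : GF} (hs : MvPowerSeries.constantCoeff s = 0) {f : GF}
    (hf : ∀ e : Fin 3 →₀ ℕ, e 1 ≠ 0 → MvPowerSeries.coeff e f = 0) : substUHom hs f = f := by
  -- Compare with the identity substitution, monomial by monomial: those involving `u` have zero
  -- coefficient, and the others do not see `s`.
  conv_rhs => rw [← id_eq f, ← MvPowerSeries.subst_self (R := Polynomial ℤ)]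
  rw [substUHom_apply, substU]
  ext e : 1
  rw [MvPowerSeries.coeff_subst (hasSubst_substU hs),
    MvPowerSeries.coeff_subst MvPowerSeries.HasSubst.X]
  refine finsum_congr fun d => ?_
  by_cases hd : d 1 = 0
  · congr 2
    refine Finsupp.prod_congr fun i hi => ?_
    fin_cases i
    · rfl
    · simp [hd] at hi
    · rfl
  · rw [hf d hd, zero_smul, zero_smul]

theorem substUHom_embX {s : GF} (hs : MvPowerSeries.constantCoeff s = 0)
    (g : PowerSeries (Polynomial ℤ)) : substUHom hs (embX g) = embX g := by
  refine substUHom_of_coeff_eq_zero hs fun e he => ?_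
  have h1 : Finsupp.tail e ≠ 0 := fun h => he (DFunLike.congr_fun h 0)
  have := congrArg (PowerSeries.coeff (e 0)) (slice_embX (Finsupp.tail e) g)
  rw [if_neg h1] at this
  simpa [slice, Finsupp.cons_tail] using this

theorem embX_X : embX PowerSeries.X = gx := embFirst_X

theorem embX_C (p : Polynomial ℤ) : embX (PowerSeries.C p) = MvPowerSeries.C p := embFirst_C p

theorem constantCoeff_embX (g : PowerSeries (Polynomial ℤ)) :
    MvPowerSeries.constantCoeff (embX g) = PowerSeries.constantCoeff g := by
  have := congrArg (PowerSeries.coeff 0) (slice_embX 0 g)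
  simpa [slice] using this

/-! ### Functional equations -/

section Equations

variable {a m : ℕ}

theorem ncGF_eq (a m : ℕ) : ncGF a m = embX (prefSer a m 0) := by
  refine GF.ext_slice fun d => ?_
  rw [slice_embX]
  ext n : 1
  rw [slice, PowerSeries.coeff_mk, MvPowerSeries.coeff_apply, ncGF]
  have h1 : Finsupp.cons n d (1 : Fin 3) = d 0 := Finsupp.cons_succ (0 : Fin 2) n d
  have h2 : Finsupp.cons n d (2 : Fin 3) = d 1 := Finsupp.cons_succ (1 : Fin 2) n d
  have h3 : d = 0 ↔ d 0 = 0 ∧ d 1 = 0 := by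
    rw [Finsupp.ext_iff, Fin.forall_fin_two]; rfl
  rw [h1, h2, Finsupp.cons_zero, if_congr h3 rfl rfl]
  simp only [occ_word]
  split_ifs
  · rw [prefSer, PowerSeries.coeff_mk, cnt]
  · simp

theorem A2_eq (a m : ℕ) : A2 a m = ser 0 (prefSer a m) := by
  refine GF.ext_slice fun d => ?_
  rw [slice_ser]
  ext n : 1
  rw [slice, PowerSeries.coeff_mk, MvPowerSeries.coeff_apply, A2]
  have h1 : Finsupp.cons n d (1 : Fin 3) = d 0 := Finsupp.cons_succ (0 : Fin 2) n d
  have h2 : Finsupp.cons n d (2 : Fin 3) = d 1 := Finsupp.cons_succ (1 : Fin 2) n d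
  have h3 : d = Finsupp.single 0 (d 0) ↔ d 1 = 0 := by
    rw [Finsupp.ext_iff, Fin.forall_fin_two]; simp
  rw [h1, h2, Finsupp.cons_zero, if_congr h3 rfl rfl]
  split_ifs <;> simp [prefSer]

theorem single_one_iff (d : Fin 2 →₀ ℕ) : d = Finsupp.single 1 (d 1) ↔ d 0 = 0 := by
  rw [Finsupp.ext_iff, Fin.forall_fin_two]; simp

theorem jointGF_eq (a m : ℕ) : jointGF a m = ser 1 (repSer a m 0) := by
  refine GF.ext_slice fun d => ?_
  rw [slice_ser]
  ext n : 1
  rw [slice, PowerSeries.coeff_mk, MvPowerSeries.coeff_apply, jointGF]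
  have h1 : Finsupp.cons n d (1 : Fin 3) = d 0 := Finsupp.cons_succ (0 : Fin 2) n d
  have h2 : Finsupp.cons n d (2 : Fin 3) = d 1 := Finsupp.cons_succ (1 : Fin 2) n d
  rw [h1, h2, Finsupp.cons_zero, if_congr (single_one_iff d) rfl rfl]
  simp only [occ_word]
  split_ifs
  · rw [repSer, PowerSeries.coeff_mk, cntRep]
  · simp

/-- The polynomial `∑_{j<a} C_j x^j`. -/
def catPoly {R : Type*} [CommRing R] (a : ℕ) (x : R) : R :=
  ∑ j ∈ Finset.range a, (catalan j : R) * x ^ j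

/-- The polynomial `∑_{j=1}^{a-1} (C_j - C_{j-1}) x^j`. -/
def catDiff {R : Type*} [CommRing R] (a : ℕ) (x : R) : R :=
  catPoly a x - 1 - x * catPoly a x + (catalan (a - 1) : R) * x ^ a

theorem map_catPoly {R S : Type*} [CommRing R] [CommRing S] (f : R →+* S) (a : ℕ) (x : R) :
    f (catPoly a x) = catPoly a (f x) := by
  simp [catPoly, map_sum]

theorem map_catDiff {R S : Type*} [CommRing R] [CommRing S] (f : R →+* S) (a : ℕ) (x : R) :
    f (catDiff a x) = catDiff a (f x) := by
  simp [catDiff, map_catPoly]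

/-! ### Catalan coefficients in small degree and the truncated series. -/

theorem coeff_natCast_mul (k n : ℕ) (f : PowerSeries (Polynomial ℤ)) :
    PowerSeries.coeff n ((k : PowerSeries (Polynomial ℤ)) * f) = k * PowerSeries.coeff n f := by
  rw [← map_natCast PowerSeries.C, PowerSeries.coeff_C_mul]

theorem coeff_catPoly (n : ℕ) :
    PowerSeries.coeff n (catPoly a (PowerSeries.X : PowerSeries (Polynomial ℤ))) =
      if n < a then (catalan n : Polynomial ℤ) else 0 := by
  simp [catPoly, map_sum, coeff_natCast_mul, PowerSeries.coeff_X_pow]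

/-- Below degree `a` the coefficients are the Catalan differences in `catDiff`, whose last summand
cancels its own term of degree `a`. -/
theorem coeff_repSer_sub_catDiff (ha : 2 ≤ a) (hm : 2 ≤ m) (l n : ℕ) :
    PowerSeries.coeff n (repSer a m l 1 - catDiff a PowerSeries.X) =
      if a ≤ n then PowerSeries.coeff n (repSer a m l 1) else 0 := by
  rw [catDiff, map_sub, map_add, map_sub, map_sub, coeff_catPoly, coeff_natCast_mul,
    PowerSeries.coeff_X_pow, PowerSeries.coeff_one]
  cases n with
  | zero =>
    rw [PowerSeries.coeff_zero_X_mul, coeff_repSer_one_zero ha hm, if_pos (by omega), if_pos rfl,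
      if_neg (by omega), ite_self]
    simp
  | succ n =>
    rw [PowerSeries.coeff_succ_X_mul, coeff_catPoly]
    by_cases h : n + 1 < a
    · rw [coeff_repSer_one_succ_of_lt ha hm n h, if_pos h, if_neg n.succ_ne_zero,
        if_pos (by omega), if_neg (by omega), if_neg (by omega)]
      ring
    · rcases eq_or_lt_of_le (not_lt.1 h) with h' | h'
      · subst h'
        simp
      · rw [if_neg h, if_neg (by omega), if_neg (by omega), if_neg (by omega), if_pos (by omega)]
        ring

/-- With k = i - 1, the range i ≤ n - a + 1 says n - k ≥ a: once x^k is factored out, the truncation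
is the removal of degrees below `a`. -/
theorem substU_zero_A3 (ha : 2 ≤ a) (hm : 2 ≤ m) : substU 0 (A3 a m) =
    ser 1 (fun k => PowerSeries.X ^ k * (repSer a m k 1 - catDiff a PowerSeries.X)) := by
  have h0 : MvPowerSeries.constantCoeff (0 : GF) = 0 := map_zero _
  -- The part free of `u`; the remainder is divisible by `u` and dies at u = 0.
  set f : GF := fun e => if e 1 = 0 then A3 a m e else 0 with hf
  have h1 : gu ∣ A3 a m - f := by
    rw [gu, MvPowerSeries.X_dvd_iff]
    intro e he
    rw [map_sub, MvPowerSeries.coeff_apply, MvPowerSeries.coeff_apply, hf]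
    simp [he]
  obtain ⟨g, hg⟩ := h1
  have h2 : A3 a m = f + gu * g := by rw [← hg]; ring
  rw [← substUHom_apply h0, h2, map_add, map_mul, substUHom_gu, zero_mul, add_zero,
    substUHom_of_coeff_eq_zero h0 fun e he => by rw [MvPowerSeries.coeff_apply, hf]; simp [he]]
  refine GF.ext_slice fun d => ?_
  rw [slice_ser, if_congr (single_one_iff d) rfl rfl]
  ext n : 1
  have h1 : Finsupp.cons n d (1 : Fin 3) = d 0 := Finsupp.cons_succ (0 : Fin 2) n d
  have h2 : Finsupp.cons n d (2 : Fin 3) = d 1 := Finsupp.cons_succ (1 : Fin 2) n d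
  rw [slice, PowerSeries.coeff_mk, MvPowerSeries.coeff_apply, hf]
  simp only [A3, h1, h2, Finsupp.cons_zero]
  by_cases hd : d 0 = 0
  · rw [if_pos hd, if_pos hd, hd, PowerSeries.coeff_X_pow_mul']
    have h3 : cntRep a m 0 n (d 1 + 1) =
        PowerSeries.coeff n (PowerSeries.X ^ d 1 * repSer a m (d 1) 1) := by
      have := repSer_succ ha hm 0 (d 1)
      rw [zero_add] at this
      rw [← this, repSer, PowerSeries.coeff_mk]
    rw [h3, PowerSeries.coeff_X_pow_mul', coeff_repSer_sub_catDiff ha hm]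
    by_cases h4 : d 1 ≤ n
    · rw [if_pos h4, if_pos h4]
      exact if_congr (by omega) rfl rfl
    · rw [if_neg h4, if_neg h4, ite_self]
  · rw [if_neg hd, if_neg hd, map_zero]

/-- For fixed j ≥ 1 the summation range says 1 ≤ n - j ≤ a - 2, giving x^j times the Catalan
polynomial without its constant and top terms. -/
theorem tailGF_eq (ha : 2 ≤ a) : tailGF a =
    ser 1 (fun k => if 1 ≤ k then PowerSeries.X ^ k * (catPoly a PowerSeries.X - 1 -
      (catalan (a - 1) : PowerSeries (Polynomial ℤ)) * PowerSeries.X ^ (a - 1)) else 0) := by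
  refine GF.ext_slice fun d => ?_
  rw [slice_ser, if_congr (single_one_iff d) rfl rfl]
  ext n : 1
  have h1 : Finsupp.cons n d (1 : Fin 3) = d 0 := Finsupp.cons_succ (0 : Fin 2) n d
  have h2 : Finsupp.cons n d (2 : Fin 3) = d 1 := Finsupp.cons_succ (1 : Fin 2) n d
  rw [slice, PowerSeries.coeff_mk, MvPowerSeries.coeff_apply, tailGF, h1, h2, Finsupp.cons_zero]
  by_cases hd : d 0 = 0
  swap
  · simp [hd]
  rw [if_pos hd]
  simp only [hd, true_and, Finset.mem_Icc]
  by_cases hk : 1 ≤ d 1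
  swap
  · rw [if_neg (by omega), if_neg hk, map_zero]
  rw [if_pos hk, PowerSeries.coeff_X_pow_mul']
  by_cases hn : d 1 ≤ n
  swap
  · rw [if_neg (by omega), if_neg hn]
  rw [if_pos hn, map_sub, map_sub, coeff_catPoly, coeff_natCast_mul, PowerSeries.coeff_X_pow,
    PowerSeries.coeff_one]
  rcases Nat.eq_zero_or_pos (n - d 1) with h | h
  · rw [if_neg (by omega), if_pos (by omega), if_pos h, if_neg (by omega), h]
    simp
  · rw [if_neg h.ne']
    rcases lt_trichotomy (n - d 1) (a - 1) with h' | h' | h'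
    · rw [if_pos (by omega), if_pos (by omega), if_neg (by omega)]; ring
    · rw [if_neg (by omega), if_pos (by omega), if_pos h', h']; ring
    · rw [if_neg (by omega), if_neg (by omega), if_neg (by omega)]; ring

/-- The functional equation of `A(x,u)`. -/
theorem gu_mul_A2 (ha : 2 ≤ a) (hm : 2 ≤ m) :
    gu * A2 a m * (1 - gu) = gu + gx * ncGF a m * (A2 a m - ncGF a m) * (1 - gu) +
      (gq - 1) * gx ^ (a - 1) * (ncGF a m - 1) * gu ^ m := by
  have hgeo : ser 0 (fun _ => 1) * (1 - gu) = 1 := by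
    have := ser_eq 0 (fun _ => 1)
    rw [map_one] at this
    change _ = 1 + gu * _ at this
    linear_combination this
  set c := PowerSeries.C (Polynomial.X - 1 : Polynomial ℤ) *
    (PowerSeries.X ^ (a - 1) * (prefSer a m 0 - 1)) with hc
  have hcE : embX c = (gq - 1) * gx ^ (a - 1) * (ncGF a m - 1) := by
    rw [hc, map_sub PowerSeries.C, map_mul, map_mul, map_sub, map_sub, embX_C, map_one, map_one,
      map_pow, embX_X, ← ncGF_eq, gq]
    ring
  -- The recurrence `prefSer_eq` summed against u^l.
  have hrec : A2 a m = ser 0 (fun _ => 1) + gx * ncGF a m * ser 0 (fun k => prefSer a m (k + 1)) +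
      gu ^ (m - 1) * (embX c * ser 0 (fun _ => 1)) := by
    rw [← ser_mul_left, mul_one, ncGF_eq, ← embX_X, ← map_mul, ← ser_mul_left, A2_eq]
    have := ser_ite 0 (m - 1) (fun _ => c)
    change _ = gu ^ (m - 1) * _ at this
    rw [← this, ← ser_add, ← ser_add]
    congr 1
    funext l
    rw [prefSer_eq ha hm l, mul_assoc]
  have hshift := ser_eq 0 (prefSer a m)
  rw [← A2_eq, ← ncGF_eq] at hshift
  change _ = _ + gu * _ at hshift
  rw [← hcE]
  obtain ⟨k, rfl⟩ : ∃ k, m = k + 1 := ⟨m - 1, by omega⟩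
  rw [Nat.add_sub_cancel] at hrec
  linear_combination gu * (1 - gu) * hrec + (gu + gu ^ (k + 1) * embX c) * hgeo -
    gx * ncGF a (k + 1) * (1 - gu) * hshift

/-! ### Specializations of the functional equation. -/

theorem substUHom_A2 (ha : 2 ≤ a) (hm : 2 ≤ m) {s : GF}
    (hs : MvPowerSeries.constantCoeff s = 0) :
    s * substU s (A2 a m) * (1 - s) =
      s + gx * ncGF a m * (substU s (A2 a m) - ncGF a m) * (1 - s) +
        (gq - 1) * gx ^ (a - 1) * (ncGF a m - 1) * s ^ m := by
  have h := congrArg (substUHom hs) (gu_mul_A2 ha hm)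
  have hx : substUHom hs gx = gx := by rw [← embX_X, substUHom_embX]
  have hq : substUHom hs gq = gq := by rw [gq, ← embX_C, substUHom_embX]
  have hy : substUHom hs (ncGF a m) = ncGF a m := by rw [ncGF_eq, substUHom_embX]
  simpa only [map_mul, map_add, map_sub, map_pow, map_one, substUHom_gu, hx, hq, hy,
    substUHom_apply hs (A2 a m)] using h

theorem constantCoeff_ncGF (ha : 2 ≤ a) (hm : 2 ≤ m) :
    MvPowerSeries.constantCoeff (ncGF a m) = 1 := by
  rw [ncGF_eq, constantCoeff_embX, constantCoeff_prefSer ha hm]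

theorem gx_ne_zero : gx ≠ 0 := by
  intro h
  have := congrArg (MvPowerSeries.coeff (Finsupp.single 0 1)) h
  rw [gx, MvPowerSeries.coeff_index_single_self_X] at this
  simp at this

theorem ncGF_ne_zero (ha : 2 ≤ a) (hm : 2 ≤ m) : ncGF a m ≠ 0 := by
  intro h
  have := constantCoeff_ncGF ha hm
  rw [h] at this
  simp at this

theorem substU_zero_A2 (ha : 2 ≤ a) (hm : 2 ≤ m) : substU 0 (A2 a m) = ncGF a m := by
  have h := substUHom_A2 ha hm (s := 0) (map_zero _)
  rw [zero_pow (by omega)] at h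
  have h2 : gx * ncGF a m * (substU 0 (A2 a m) - ncGF a m) = 0 := by linear_combination -h
  exact sub_eq_zero.1 ((mul_eq_zero.1 h2).resolve_left
    (mul_ne_zero gx_ne_zero (ncGF_ne_zero ha hm)))

/-- The kernel method: `u = xy` annihilates the coefficient of `A(x,u)`. -/
theorem ncGF_equation (ha : 2 ≤ a) (hm : 2 ≤ m) :
    gx * ncGF a m ^ 2 - ncGF a m + 1 +
      (gq - 1) * gx ^ (a + m - 2) * ncGF a m ^ (m - 1) * (ncGF a m - 1) = 0 := by
  have h := substUHom_A2 ha hm (s := gx * ncGF a m) (by simp [gx])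
  obtain ⟨k, rfl⟩ : ∃ k, m = k + 1 := ⟨m - 1, by omega⟩
  obtain ⟨b, rfl⟩ : ∃ b, a = b + 1 := ⟨a - 1, by omega⟩
  have h3 : b + 1 + (k + 1) - 2 = b + k := by omega
  rw [h3]
  simp only [Nat.add_sub_cancel] at h ⊢
  refine (mul_eq_zero.1 (?_ : gx * ncGF (b + 1) (k + 1) * _ = 0)).resolve_left
    (mul_ne_zero gx_ne_zero (ncGF_ne_zero ha hm))
  rw [mul_pow] at h
  linear_combination -h

/-! ### The variable v: smallest repeated letter and the substitution u = vx. -/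

theorem geom_v : ser 1 (fun k => PowerSeries.X ^ k) * (1 - gv * gx) = 1 := by
  have := ser_eq 1 (fun k => PowerSeries.X ^ k)
  rw [pow_zero, map_one] at this
  simp only [pow_succ'] at this
  rw [ser_mul_left, embX_X] at this
  change _ = 1 + gv * _ at this
  linear_combination this

theorem ser_prefSer_v (a m : ℕ) :
    ser 1 (fun k => PowerSeries.X ^ k * prefSer a m k) = ncGF a m +
      gv * ser 1 (fun k => PowerSeries.X ^ (k + 1) * prefSer a m (k + 1)) := by
  have := ser_eq 1 (fun k => PowerSeries.X ^ k * prefSer a m k)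
  rwa [pow_zero, one_mul, ← ncGF_eq] at this

/-- The contribution of the occurrences that start in the prefix. -/
theorem ser_ite_v (ha : 2 ≤ a) (hm : 2 ≤ m) :
    ser 1 (fun k => if m - 1 ≤ k then PowerSeries.X ^ k *
      (PowerSeries.C (Polynomial.X - 1 : Polynomial ℤ) *
        (PowerSeries.X ^ (a - 1) * (prefSer a m 0 - 1))) else 0) =
      gv ^ (m - 1) * ((gq - 1) * gx ^ (a + m - 2) * (ncGF a m - 1) *
        ser 1 (fun k => PowerSeries.X ^ k)) := by
  rw [ser_ite]
  change gv ^ (m - 1) * _ = _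
  congr 1
  have h1 : ∀ k, (PowerSeries.X : PowerSeries (Polynomial ℤ)) ^ (k + (m - 1)) *
      (PowerSeries.C (Polynomial.X - 1 : Polynomial ℤ) *
        (PowerSeries.X ^ (a - 1) * (prefSer a m 0 - 1))) =
      (PowerSeries.C (Polynomial.X - 1 : Polynomial ℤ) *
        PowerSeries.X ^ (a + m - 2) * (prefSer a m 0 - 1)) * PowerSeries.X ^ k := by
    intro k
    rw [show a + m - 2 = (a - 1) + (m - 1) by omega, pow_add, pow_add]
    ring
  simp only [h1]
  rw [ser_mul_left, map_sub PowerSeries.C, map_mul, map_mul, map_sub, map_sub, embX_C, map_one,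
    map_one, map_pow, embX_X, ← ncGF_eq, gq]

theorem gv_sub_ncGF_ne_zero (ha : 2 ≤ a) (hm : 2 ≤ m) : gv - ncGF a m ≠ 0 := by
  intro h
  have := congrArg MvPowerSeries.constantCoeff h
  rw [map_sub, constantCoeff_ncGF ha hm] at this
  simp [gv] at this

theorem one_sub_gv_gx_ne_zero : 1 - gv * gx ≠ 0 := right_ne_zero_of_mul_eq_one geom_v

/-- Both sides solve the same linear equation, the left by specializing the functional equation, the
right by summing the recurrence. The solution is unique because x(v - y)(1 - vx) is nonzero. -/
theorem substU_vx_A2 (ha : 2 ≤ a) (hm : 2 ≤ m) :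
    substU (gv * gx) (A2 a m) = ser 1 (fun k => PowerSeries.X ^ k * prefSer a m k) := by
  have h := substUHom_A2 ha hm (s := gv * gx) (by simp [gx])
  have hrec : ser 1 (fun k => PowerSeries.X ^ k * prefSer a m k) =
      ser 1 (fun k => PowerSeries.X ^ k) +
      ncGF a m * ser 1 (fun k => PowerSeries.X ^ (k + 1) * prefSer a m (k + 1)) +
      gv ^ (m - 1) * ((gq - 1) * gx ^ (a + m - 2) * (ncGF a m - 1) *
        ser 1 (fun k => PowerSeries.X ^ k)) := by
    rw [← ser_ite_v ha hm]
    nth_rw 1 [ncGF_eq]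
    rw [← ser_mul_left, ← ser_add, ← ser_add]
    congr 1
    funext k
    conv_lhs => rw [prefSer_eq ha hm k]
    split_ifs <;> ring
  have hshift := ser_prefSer_v a m
  have hgeo := geom_v
  set B := ser 1 (fun k => PowerSeries.X ^ k * prefSer a m k)
  set g := ser 1 (fun k => (PowerSeries.X : PowerSeries (Polynomial ℤ)) ^ k)
  obtain ⟨k, rfl⟩ : ∃ k, m = k + 1 := ⟨m - 1, by omega⟩
  obtain ⟨b, rfl⟩ : ∃ b, a = b + 1 := ⟨a - 1, by omega⟩
  have h3 : b + 1 + (k + 1) - 2 = b + k := by omega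
  rw [h3] at hrec
  simp only [Nat.add_sub_cancel] at h hrec
  refine sub_eq_zero.1 ((mul_eq_zero.1
    (?_ : (gx * (gv - ncGF (b + 1) (k + 1)) * (1 - gv * gx)) * _ = 0)).resolve_left
    (mul_ne_zero (mul_ne_zero gx_ne_zero (gv_sub_ncGF_ne_zero ha hm)) one_sub_gv_gx_ne_zero))
  rw [mul_pow] at h
  linear_combination h - gv * gx * (1 - gv * gx) * hrec +
    gx * ncGF (b + 1) (k + 1) * (1 - gv * gx) * hshift -
    gv * gx * (1 + gv ^ k * (gq - 1) * gx ^ (b + k) * (ncGF (b + 1) (k + 1) - 1)) * hgeo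

theorem jointGF_eq_add (ha : 2 ≤ a) (hm : 2 ≤ m) :
    jointGF a m * (1 - gx) = 1 +
      gv * ser 1 (fun k => PowerSeries.X ^ k * repSer a m k 1) * (1 - gx) := by
  have h := ser_eq 1 (repSer a m 0)
  rw [repSer_zero ha hm] at h
  simp only [repSer_succ ha hm 0, zero_add] at h
  rw [jointGF_eq, h]
  change (_ + gv * _) * _ = _
  have h2 : embX (PowerSeries.mk 1) * (1 - gx) = 1 := by
    rw [← embX_X, ← map_one embX, ← map_sub, ← map_mul, PowerSeries.mk_one_mul_one_sub_eq_one]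
  linear_combination h2

/-- Inserting the recurrence into F_k - 1 - x F_{k+1} leaves (y-1) x F_{k+1} plus the correction;
summation against (vx)^k then produces A(x,vx) - y. -/
theorem gv_mul_ser_repSer (ha : 2 ≤ a) (hm : 2 ≤ m) :
    gv * ser 1 (fun k => PowerSeries.X ^ k * repSer a m k 1) * (1 - gv * gx) =
      (ncGF a m - 1) * (substU (gv * gx) (A2 a m) - ncGF a m) * (1 - gv * gx) +
        gv ^ m * ((gq - 1) * gx ^ (a + m - 2) * (ncGF a m - 1)) := by
  have h : ser 1 (fun k => PowerSeries.X ^ k * repSer a m k 1) =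
      (ncGF a m - 1) * ser 1 (fun k => PowerSeries.X ^ (k + 1) * prefSer a m (k + 1)) +
      gv ^ (m - 1) * ((gq - 1) * gx ^ (a + m - 2) * (ncGF a m - 1) *
        ser 1 (fun k => PowerSeries.X ^ k)) := by
    rw [← ser_ite_v ha hm]
    nth_rw 1 [ncGF_eq]
    rw [← map_one embX, ← map_sub, ← ser_mul_left, ← ser_add]
    congr 1
    funext k
    rw [repSer_one ha hm, prefSer_eq ha hm k]
    split_ifs <;> ring
  have hshift := ser_prefSer_v a m
  rw [← substU_vx_A2 ha hm] at hshift
  obtain ⟨k, rfl⟩ : ∃ k, m = k + 1 := ⟨m - 1, by omega⟩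
  rw [Nat.add_sub_cancel] at h
  linear_combination gv * (1 - gv * gx) * h -
    (ncGF a (k + 1) - 1) * (1 - gv * gx) * hshift +
    gv ^ (k + 1) * ((gq - 1) * gx ^ (a + (k + 1) - 2) * (ncGF a (k + 1) - 1)) * geom_v

/-- The truncation loses the same polynomial `catDiff` for each `k`, with weight (vx)^k. -/
theorem ser_repSer_eq (ha : 2 ≤ a) (hm : 2 ≤ m) :
    ser 1 (fun k => PowerSeries.X ^ k * repSer a m k 1) * (1 - gv * gx) =
      substU 0 (A3 a m) * (1 - gv * gx) + catDiff a gx := by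
  have h : ser 1 (fun k => PowerSeries.X ^ k * repSer a m k 1) = substU 0 (A3 a m) +
      catDiff a gx * ser 1 (fun k => PowerSeries.X ^ k) := by
    rw [substU_zero_A3 ha hm, ← embX_X, ← map_catDiff, ← ser_mul_left, ← ser_add]
    congr 1
    funext k
    ring
  linear_combination (1 - gv * gx) * h + catDiff a gx * geom_v

theorem tailGF_mul (ha : 2 ≤ a) : tailGF a * (1 - gv * gx) =
    gv * gx * (catPoly a gx - 1 - (catalan (a - 1) : GF) * gx ^ (a - 1)) := by
  rw [tailGF_eq ha, ser_ite]
  have h1 : ∀ k, (PowerSeries.X : PowerSeries (Polynomial ℤ)) ^ (k + 1) *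
      (catPoly a PowerSeries.X - 1 -
        (catalan (a - 1) : PowerSeries (Polynomial ℤ)) * PowerSeries.X ^ (a - 1)) =
      PowerSeries.X * (catPoly a PowerSeries.X - 1 -
        (catalan (a - 1) : PowerSeries (Polynomial ℤ)) * PowerSeries.X ^ (a - 1)) *
        PowerSeries.X ^ k := by
    intro k; ring
  simp only [h1]
  rw [ser_mul_left, map_mul, map_sub, map_sub, map_mul, map_natCast, map_catPoly, map_pow, map_one,
    embX_X, pow_one]
  change gv * _ * _ = _
  linear_combination gv * gx * (catPoly a gx - 1 - (catalan (a - 1) : GF) * gx ^ (a - 1)) * geom_v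

end Equations

/-! ### The explicit expressions -/

/-- Passing from `b` to `b + 1` adds the diagonal i + j = b + 1 with i ≥ 1; the Catalan recurrence
without its i = 0 term sums it to C_{b+2} - C_{b+1}. At b = 0 both sides vanish, matching the
convention M = 0 for a = 2. -/
theorem mul_sum_catalan {R : Type*} [CommRing R] (b : ℕ) (x : R) :
    x * ∑ j ∈ Finset.range b, ∑ i ∈ Finset.Icc 1 (b - j),
      (catalan i : R) * (catalan j : R) * x ^ (i + j) = catDiff (b + 2) x := by
  induction b with
  | zero => simp [catDiff, catPoly, Finset.sum_range_succ]; ring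
  | succ b ih =>
    have h1 : ∑ j ∈ Finset.range (b + 1), ∑ i ∈ Finset.Icc 1 (b + 1 - j),
        (catalan i : R) * (catalan j : R) * x ^ (i + j) =
        ∑ j ∈ Finset.range b, ∑ i ∈ Finset.Icc 1 (b - j),
          (catalan i : R) * (catalan j : R) * x ^ (i + j) +
        ∑ j ∈ Finset.range (b + 1), (catalan (b + 1 - j) : R) * (catalan j : R) * x ^ (b + 1) := by
      rw [show ∑ j ∈ Finset.range b, ∑ i ∈ Finset.Icc 1 (b - j),
          (catalan i : R) * (catalan j : R) * x ^ (i + j) =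
          ∑ j ∈ Finset.range (b + 1), ∑ i ∈ Finset.Icc 1 (b - j),
            (catalan i : R) * (catalan j : R) * x ^ (i + j) by
        rw [Finset.sum_range_succ]; simp, ← Finset.sum_add_distrib]
      refine Finset.sum_congr rfl fun j hj => ?_
      have hj : j ≤ b := by simpa [Nat.lt_succ_iff] using hj
      rw [show b + 1 - j = (b - j) + 1 by omega, Finset.sum_Icc_succ_top (by omega),
        show b - j + 1 + j = b + 1 by omega]
    have h2 : ∑ j ∈ Finset.range (b + 1), (catalan (b + 1 - j) : R) * (catalan j : R) =
        catalan (b + 2) - catalan (b + 1) := by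
      rw [eq_sub_iff_add_eq, show b + 2 = b + 1 + 1 from rfl, catalan_succ' (b + 1), Finset.Nat.sum_antidiagonal_eq_sum_range_succ_mk,
        Finset.sum_range_succ _ (b + 1)]
      push_cast
      simp [mul_comm]
    rw [h1, mul_add, ih, ← Finset.sum_mul, h2, catDiff, catDiff, catPoly, catPoly,
      show b + 1 + 2 = (b + 2) + 1 by ring, Finset.sum_range_succ _ (b + 2),
      Nat.add_sub_cancel, show b + 2 - 1 = b + 1 by omega]
    ring

section Field

variable {F : Type*} [Field F] {a m : ℕ} {q x u v y : F}

theorem Mser_eq (ha : 2 ≤ a) (x u v : F) :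
    Mser a x u v = catDiff a x / ((1 - u) * (1 - v * x)) := by
  obtain ⟨b, rfl⟩ : ∃ b, a = b + 2 := ⟨a - 2, by omega⟩
  rw [← mul_sum_catalan, Mser, Nat.add_sub_cancel]
  split_ifs with h
  · obtain rfl : b = 0 := by omega
    simp
  · rw [mul_div_right_comm]

/-- Makes the Catalan terms in `exprA` and `exprAxx` collapse to 1/((1-u)(1-x)), with u = xy in the
latter. -/
theorem Lser_eq (ha : 2 ≤ a) (hx : 1 - x ≠ 0) (hu : 1 - u ≠ 0) :
    Lser a x u = 1 / ((1 - u) * (1 - x)) - x ^ a * (catalan (a - 1) : F) / ((1 - u) * (1 - x)) +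
      Mser a x u 1 := by
  rw [Mser_eq ha, one_mul, Lser]
  change 1 / (1 - u) * catPoly a x = _
  rw [catDiff]
  field_simp
  ring

theorem eq_exprAxx (ha : 2 ≤ a) (hm : 2 ≤ m) {A : F} (hx0 : x ≠ 0) (hy1 : y ≠ 1)
    (hx : 1 - x ≠ 0) (hxy : 1 - x * y ≠ 0)
    (hy : x * y ^ 2 - y + 1 + (q - 1) * x ^ (a + m - 2) * y ^ (m - 1) * (y - 1) = 0)
    (hA : x * A * (1 - x) = x + x * y * (A - y) * (1 - x) +
      (q - 1) * x ^ (a - 1) * (y - 1) * x ^ m) :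
    A = exprAxx a m q x y := by
  obtain ⟨b, rfl⟩ : ∃ b, a = b + 2 := ⟨a - 2, by omega⟩
  obtain ⟨k, rfl⟩ : ∃ k, m = k + 1 := ⟨m - 1, by omega⟩
  have e1 : b + 2 + (k + 1) - 2 = b + k + 1 := by omega
  have e2 : b + 2 - 1 = b + 1 := by omega
  rw [e1, Nat.add_sub_cancel] at hy
  rw [e2] at hA
  have key : A = ((q - 1) * x ^ b * ((x * y) ^ (k + 1) * (1 - x) - x ^ (k + 1) * (1 - x * y)) + 1)
      / ((1 - x) * (1 - x * y)) := by
    rw [eq_div_iff (mul_ne_zero hx hxy)]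
    -- At u = x the kernel is x(1 - y); the polynomial equation for `y` makes the right side
    -- divisible by this factor.
    refine mul_left_cancel₀ (mul_ne_zero hx0 (sub_ne_zero.2 hy1.symm)) ?_
    rw [mul_pow]
    linear_combination (1 - x * y) * hA + x * y * (1 - x) * hy
  rw [key, exprAxx, Lser_eq ha hx hxy, Nat.add_sub_cancel, mul_comm (1 - x * y) (1 - x)]
  ring

/-- Combining the equations at `u` and at `x` eliminates the term x y², which is why A(x,x) enters
the formula. -/
theorem eq_exprA (ha : 2 ≤ a) {A A₁ : F} (hx : 1 - x ≠ 0) (hu : 1 - u ≠ 0)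
    (hxu : x - u ≠ 0) (hxyu : x * y - u ≠ 0) (hA₁ : A₁ = exprAxx a m q x y)
    (hA₁x : x * A₁ * (1 - x) = x + x * y * (A₁ - y) * (1 - x) +
      (q - 1) * x ^ (a - 1) * (y - 1) * x ^ m)
    (hA : u * A * (1 - u) = u + x * y * (A - y) * (1 - u) +
      (q - 1) * x ^ (a - 1) * (y - 1) * u ^ m) :
    A = exprA a m q x y u := by
  rw [exprA, ← hA₁, Lser_eq ha hx hu]
  have key : A * (x * y - u) * ((1 - u) * (1 - x)) = (x - u) +
      (1 - q) * x ^ (a - 1) * (u ^ m * (1 - x) - x ^ m * (1 - u)) * (y - 1) +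
      x * (y - 1) * A₁ * ((1 - u) * (1 - x)) := by
    linear_combination (-(1 - x)) * hA + (1 - u) * hA₁x
  have h2 : A = ((x - u) +
      (1 - q) * x ^ (a - 1) * (u ^ m * (1 - x) - x ^ m * (1 - u)) * (y - 1) +
      x * (y - 1) * A₁ * ((1 - u) * (1 - x))) / ((x * y - u) * ((1 - u) * (1 - x))) := by
    rw [eq_div_iff (mul_ne_zero hxyu (mul_ne_zero hu hx)), ← mul_assoc, key]
  rw [h2]
  field_simp
  ring

end Field

end SubwordNC

end

/-! ### Assembly in the fraction field. -/

open SubwordNC in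
theorem theorem3p3 (a m : ℕ) (ha : 2 ≤ a) (hm : 2 ≤ m) :
    -- the polynomial equation for `y = A(x,0)`, the generating function of the `NC_n`
    (substU 0 (A2 a m) = ncGF a m ∧
      gx * ncGF a m ^ 2 - ncGF a m + 1
        + (gq - 1) * gx ^ (a + m - 2) * ncGF a m ^ (m - 1) * (ncGF a m - 1) = 0) ∧
    -- the joint distribution; from here on, equalities in the fraction field
    (∀ x u v q y J Axx Axu Axvx A0v : Frac,
      x = toFrac gx → u = toFrac gu → v = toFrac gv → q = toFrac gq →
      y = toFrac (ncGF a m) →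
      J = toFrac (jointGF a m) →
      Axx = toFrac (substU gx (A2 a m)) →
      Axu = toFrac (A2 a m) →
      Axvx = toFrac (substU (gv * gx) (A2 a m)) →
      A0v = toFrac (substU 0 (A3 a m)) →
      -- no denominator below vanishes
      (v ≠ 0 ∧ 1 - x ≠ 0 ∧ 1 - u ≠ 0 ∧ 1 - v * x ≠ 0 ∧ 1 - x * y ≠ 0 ∧ x - u ≠ 0 ∧
        x * y - u ≠ 0 ∧ x - v * x ≠ 0 ∧ x * y - v * x ≠ 0) ∧
      -- the joint generating function in terms of `A(x,0,v)`
      (a = 2 → J = v * A0v + 1 / (1 - x)) ∧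
      (3 ≤ a → J =
        v * A0v + 1 / (1 - x)
          + (v ^ 2 * x ^ a * (catalan (a - 1) : Frac) - v ^ 2 * x ^ 2) / (1 - v * x)
          + v * ∑ i ∈ Finset.Icc 2 (a - 1), (catalan i : Frac) * x ^ i
          + (v - 1) * toFrac (tailGF a)) ∧
      -- `A(x,0,v)` in terms of `y` and `A(x,vx)`
      A0v = (y - 1) * (Axvx - y) / v - Mser a x 0 v
        + (q - 1) * v ^ (m - 1) * x ^ (a + m - 2) * (y - 1) / (1 - v * x) ∧
      -- `A(x,x)`, `A(x,u)` and `A(x,vx)` in terms of `y`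
      Axx = exprAxx a m q x y ∧
      Axu = exprA a m q x y u ∧
      Axvx = exprA a m q x y (v * x)) := by
  refine ⟨⟨substU_zero_A2 ha hm, ncGF_equation ha hm⟩, ?_⟩
  intro x u v q y J Axx Axu Axvx A0v hx hu hv hq hy hJ hAxx hAxu hAxvx hA0v
  have inj : ∀ f : GF, f ≠ 0 → toFrac f ≠ 0 := fun f hf =>
    (map_ne_zero_iff toFrac (IsFractionRing.injective GF Frac)).2 hf
  have unit : ∀ f : GF, MvPowerSeries.constantCoeff f ≠ 0 → toFrac f ≠ 0 := fun f hf =>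
    inj f fun h => hf (by rw [h, map_zero])
  have hc0 : MvPowerSeries.constantCoeff (0 : GF) = 0 := map_zero _
  have hy0 := ncGF_ne_zero (a := a) (m := m) ha hm
  have hx0 : x ≠ 0 := hx ▸ inj _ gx_ne_zero
  have hv0 : v ≠ 0 := by
    rw [hv]
    refine inj _ fun h => ?_
    have := congrArg (MvPowerSeries.coeff (Finsupp.single 2 1)) h
    rw [gv, MvPowerSeries.coeff_index_single_self_X] at this
    simp at this
  have h1x : 1 - x ≠ 0 := by
    rw [hx, ← map_one toFrac, ← map_sub]; exact unit _ (by simp [gx])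
  have h1u : 1 - u ≠ 0 := by
    rw [hu, ← map_one toFrac, ← map_sub]; exact unit _ (by simp [gu])
  have h1vx : 1 - v * x ≠ 0 := by
    rw [hv, hx, ← map_one toFrac, ← map_mul, ← map_sub]; exact unit _ (by simp [gx])
  have h1xy : 1 - x * y ≠ 0 := by
    rw [hy, hx, ← map_one toFrac, ← map_mul, ← map_sub]; exact unit _ (by simp [gx])
  have subst_x : substUHom hc0 gx = gx := by rw [← embX_X, substUHom_embX]
  have hxu : x - u ≠ 0 := by
    rw [hx, hu, ← map_sub]
    -- Setting u = 0 in a hypothetical x = u would give x = 0.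
    refine inj _ fun h => gx_ne_zero ?_
    have := congrArg (substUHom hc0) h
    rwa [map_sub, substUHom_gu, subst_x, sub_zero, map_zero] at this
  have hxyu : x * y - u ≠ 0 := by
    rw [hx, hu, hy, ← map_mul, ← map_sub]
    refine inj _ fun h => mul_ne_zero gx_ne_zero hy0 ?_
    have := congrArg (substUHom hc0) h
    rwa [map_sub, map_mul, substUHom_gu, subst_x, sub_zero, map_zero, ncGF_eq, substUHom_embX,
      ← ncGF_eq] at this
  have hxvx : x - v * x ≠ 0 := by
    have : 1 - v ≠ 0 := by
      rw [hv, ← map_one toFrac, ← map_sub]; exact unit _ (by simp [gv])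
    rw [show x - v * x = x * (1 - v) by ring]
    exact mul_ne_zero hx0 this
  have hxyvx : x * y - v * x ≠ 0 := by
    have : v - y ≠ 0 := by
      rw [hv, hy, ← map_sub]; exact inj _ (gv_sub_ncGF_ne_zero ha hm)
    rw [show x * y - v * x = -(x * (v - y)) by ring]
    exact neg_ne_zero.2 (mul_ne_zero hx0 this)
  have hyeq : x * y ^ 2 - y + 1 + (q - 1) * x ^ (a + m - 2) * y ^ (m - 1) * (y - 1) = 0 := by
    have := congrArg toFrac (ncGF_equation (a := a) (m := m) ha hm)
    simpa only [map_add, map_sub, map_mul, map_pow, map_one, map_zero, ← hx, ← hy, ← hq] using this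
  -- At y = 1 the polynomial equation reduces to x = 0.
  have hy1 : y ≠ 1 := by
    rintro rfl
    exact hx0 (by linear_combination hyeq)
  have hAx : x * Axx * (1 - x) = x + x * y * (Axx - y) * (1 - x) +
      (q - 1) * x ^ (a - 1) * (y - 1) * x ^ m := by
    have := congrArg toFrac (substUHom_A2 (a := a) (m := m) ha hm (s := gx) (by simp [gx]))
    simpa only [map_add, map_sub, map_mul, map_pow, map_one, ← hx, ← hy, ← hq, ← hAxx] using this
  have hAu : u * Axu * (1 - u) = u + x * y * (Axu - y) * (1 - u) +
      (q - 1) * x ^ (a - 1) * (y - 1) * u ^ m := by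
    have := congrArg toFrac (gu_mul_A2 (a := a) (m := m) ha hm)
    simpa only [map_add, map_sub, map_mul, map_pow, map_one, ← hx, ← hy, ← hq, ← hu, ← hAxu]
      using this
  have hAvx : v * x * Axvx * (1 - v * x) = v * x + x * y * (Axvx - y) * (1 - v * x) +
      (q - 1) * x ^ (a - 1) * (y - 1) * (v * x) ^ m := by
    have := congrArg toFrac (substUHom_A2 (a := a) (m := m) ha hm (s := gv * gx) (by simp [gx]))
    rw [map_mul toFrac, map_mul toFrac, ← hAxvx] at this
    simpa only [map_add, map_sub, map_mul, map_pow, map_one, ← hx, ← hy, ← hq, ← hv, ← hAxvx]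
      using this
  have hAxx' := eq_exprAxx ha hm hx0 hy1 h1x h1xy hyeq hAx
  set S := toFrac (ser 1 (fun k => PowerSeries.X ^ k * repSer a m k 1)) with hS
  have hJS : J * (1 - x) = 1 + v * S * (1 - x) := by
    have := congrArg toFrac (jointGF_eq_add (a := a) (m := m) ha hm)
    simpa only [map_add, map_sub, map_mul, map_one, ← hx, ← hv, ← hJ, ← hS] using this
  have hvS : v * S * (1 - v * x) = (y - 1) * (Axvx - y) * (1 - v * x) +
      v ^ m * ((q - 1) * x ^ (a + m - 2) * (y - 1)) := by
    have := congrArg toFrac (gv_mul_ser_repSer (a := a) (m := m) ha hm)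
    simpa only [map_add, map_sub, map_mul, map_pow, map_one, ← hx, ← hy, ← hq, ← hv, ← hAxvx, ← hS]
      using this
  have hSA : S * (1 - v * x) = A0v * (1 - v * x) + catDiff a x := by
    have := congrArg toFrac (ser_repSer_eq (a := a) (m := m) ha hm)
    simpa only [map_add, map_sub, map_mul, map_one, map_catDiff, ← hx, ← hv, ← hA0v, ← hS]
      using this
  -- A form uniform in `a`; the stated formulas for a = 2 and a ≥ 3 only rewrite the last term.
  have hJ' : J = v * A0v + 1 / (1 - x) + v * catDiff a x / (1 - v * x) := by
    field_simp
    linear_combination (1 - v * x) * hJS + v * (1 - x) * hSA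
  refine ⟨⟨hv0, h1x, h1u, h1vx, h1xy, hxu, hxyu, hxvx, hxyvx⟩, ?_, ?_, ?_, hAxx',
    eq_exprA ha h1x h1u hxu hxyu hAxx' hAx hAu,
    eq_exprA ha h1x h1vx hxvx hxyvx hAxx' hAx hAvx⟩
  · rintro rfl
    have h0 : catDiff 2 x = 0 := by
      rw [← mul_sum_catalan]; simp
    rw [hJ', h0]
    ring
  · intro ha3
    have hT : toFrac (tailGF a) = v * x * (catPoly a x - 1 -
        (catalan (a - 1) : Frac) * x ^ (a - 1)) / (1 - v * x) := by
      rw [eq_div_iff h1vx]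
      have := congrArg toFrac (tailGF_mul ha)
      simpa only [map_sub, map_mul, map_pow, map_one, map_natCast, map_catPoly, ← hx, ← hv]
        using this
    have hP : ∑ i ∈ Finset.Icc 2 (a - 1), (catalan i : Frac) * x ^ i = catPoly a x - 1 - x := by
      obtain ⟨b, rfl⟩ : ∃ b, a = b + 2 := ⟨a - 2, by omega⟩
      have : Finset.Icc 2 (b + 2 - 1) = Finset.Ico 2 (b + 2) := by
        ext i; simp; omega
      rw [this, Finset.sum_Ico_eq_sub _ (by omega), catPoly]
      simp [Finset.sum_range_succ _ 1]
      ring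
    obtain ⟨b, rfl⟩ : ∃ b, a = b + 1 := ⟨a - 1, by omega⟩
    rw [hJ', hT, hP, catDiff, Nat.add_sub_cancel]
    field_simp
    ring
  · rw [Mser_eq ha, sub_zero, one_mul]
    obtain ⟨k, rfl⟩ : ∃ k, m = k + 1 := ⟨m - 1, by omega⟩
    rw [Nat.add_sub_cancel]
    field_simp
    linear_combination hvS - v * hSA
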